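/- Let $m<n$ and let $\theta,h_1,\dots,h_m,g_1,\dots,g_k:\mathbb R^n\to\mathbb R$ be twice continuously differentiable. Consider the problem $\min\{\theta(x):x\in S\}$ with feasible set $S=\{x: h_i(x)=0\ (i=1,\dots,m),\ g_j(x)\le 0\ (j=1,\dots,k)\}$. Gradients are row vectors and $'$ denotes the transpose; for a vector $v$, $v^+$ and $v^-$ have the components $\max(0,v_i)$ and $\min(0,v_i)$. Let $h(x)=(h_i(x))_i$ and $g(x)=(g_j(x))_j$, let $A(x)$ and $B(x)$ be the matrices with rows $\nabla h_i(x)$ and $\nabla g_j(x)$, and put $$V=\tfrac12|h|^2+\tfrac12|g^+|^2,\qquad d=\det(AA'),\qquad H=d\,I_n-A'\,\mathrm{adj}(AA')\,A,$$ $$Q=d\,BHB'-d^2\,\mathrm{diag}(g^-),\qquad R=HB'\,\mathrm{adj}(Q),$$ $$F=d^4R\,\mathrm{diag}(g^-)R'(\nabla\theta)'-d^4R\,(R'(\nabla\theta)')^+-d\,(\det(Q)I_n-d\,RB)\,H\,(\det(Q)I_n-d\,B'R')(\nabla\theta)'.$$ A KKT point is a point $x\in S$ for which there are $\lambda\in\mathbb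 R^m$ and $\mu\in\mathbb R^k$, $\mu\ge0$, with $(\nabla\theta(x))'+A'(x)\lambda+B'(x)\mu=0$ and $\mu'g(x)=0$; $\Phi$ is the set of KKT points. Assume: (A1) for all $z,y\in\mathbb R^n$ with $V(y)\le V(z)$ the set $\{x: V(x)\le V(z),\ \theta(x)\le\theta(y)\}$ is compact; (A2) for every $x\in S$ the vectors $\nabla h_i(x)$ ($i=1,\dots,m$) and $\nabla g_j(x)$ for all $j$ with $g_j(x)=0$ are linearly independent; (A3) if $A'(x)h(x)+B'(x)(g(x))^+=0$, then $h(x)=0$ and $(g(x))^+=0$; (A4) $\psi_1,\psi_2:\mathbb R^n\to(0,\infty)$ are locally Lipschitz functions such that for every $z$ there is $y_z$ with $V(y_z)\le V(z)$, $\theta(y_z)\ge\theta(z)$ and $\{x: a(x)>0,\ V(x)\le V(z)\}\subseteq\{x:\theta(x)\le\theta(y_z)\}$, where $a=\psi_1\nabla\theta F-|\nabla V|^2|\nabla\theta|^2-\psi_2\nabla V(\nabla\theta)'+|\nabla V(\nabla\theta)'|^2$. Let $\sigma:\mathbb R^n\to(0,\infty)$ be locally Lipschitz and let $$f=\sigma\psi_1F-\sigma\Big(\psi_2(\nabla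 V)'+\big(|\nabla V|^2I_n-(\nabla V)'\nabla V\big)(\nabla\theta)'\Big).$$ Then $F$ and $f$ are locally Lipschitz on $\mathbb R^n$, and the system $\dot x=f(x)$ has the following properties. (i) For every $x_0\in\mathbb R^n$ the unique solution with $x(0)=x_0$ is defined for all $t\ge0$ and is bounded, and its $\omega$-limit set is non-empty, compact, connected, invariant and contained in $\Phi$. (ii) The equilibrium points of the system are exactly the KKT points. (iii) Every isolated KKT point that is a strict local minimum of the problem is a locally asymptotically stable equilibrium point. (iv) $S$ is positively invariant. -/

import Mathlib

open Set Filter Topology Matrix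

/-! ## Autonomous differential equations on `ℝⁿ` -/

/-- The Euclidean space `ℝⁿ`. -/
abbrev Rn (n : ℕ) : Type := EuclideanSpace ℝ (Fin n)

section Dynamics

/-- `x` is a solution of `ẋ = f(x)`, `x(0) = x₀` that is defined for all `t ≥ 0`
(with the one-sided derivative at `t = 0`). -/
def IsForwardSolution {n : ℕ} (f : Rn n → Rn n) (x₀ : Rn n) (x : ℝ → Rn n) : Prop :=
  x 0 = x₀ ∧ IsIntegralCurveOn x (fun _ => f) (Ici 0)

/-- `x` is a solution of `ẋ = f(x)`, `x(0) = x₀` on `[0, T)`. -/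
def IsSolutionUpTo {n : ℕ} (f : Rn n → Rn n) (x₀ : Rn n) (T : ℝ) (x : ℝ → Rn n) : Prop :=
  x 0 = x₀ ∧ IsIntegralCurveOn x (fun _ => f) (Ico 0 T)

/-- The positive limit set of a curve: all limits of `x(t_i)` along sequences `t_i → +∞`. -/
def positiveLimitSet {n : ℕ} (x : ℝ → Rn n) : Set (Rn n) :=
  {p | ∃ t : ℕ → ℝ, Tendsto t atTop atTop ∧ Tendsto (fun i => x (t i)) atTop (𝓝 p)}

/-- `M` is invariant for `ẋ = f(x)`: through every point of `M` there passes a solution that is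
defined for all times `t ∈ ℝ`, and every such solution stays in `M` for all `t ∈ ℝ`. -/
def IsInvariantSet {n : ℕ} (f : Rn n → Rn n) (M : Set (Rn n)) : Prop :=
  ∀ p ∈ M, (∃ z : ℝ → Rn n, z 0 = p ∧ IsIntegralCurve z (fun _ => f)) ∧
    ∀ z : ℝ → Rn n, z 0 = p → IsIntegralCurve z (fun _ => f) → ∀ t, z t ∈ M

/-- `M` is positively invariant for `ẋ = f(x)`: a solution on an interval `[0, T)` that starts
in `M` stays in `M`. -/
def IsPositivelyInvariantSet {n : ℕ} (f : Rn n → Rn n) (M : Set (Rn n)) : Prop :=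
  ∀ p ∈ M, ∀ (T : ℝ) (x : ℝ → Rn n), IsSolutionUpTo f p T x → ∀ t ∈ Ico 0 T, x t ∈ M

/-- `p` is a locally asymptotically stable equilibrium point of `ẋ = f(x)`:
it is an equilibrium, it is (Lyapunov) stable, and it is locally attractive. -/
def IsLocallyAsymptoticallyStable {n : ℕ} (f : Rn n → Rn n) (p : Rn n) : Prop :=
  f p = 0 ∧
  (∀ ε > 0, ∃ δ > 0, ∀ x₀, dist x₀ p < δ →
    (∃ x, IsForwardSolution f x₀ x) ∧
      ∀ x, IsForwardSolution f x₀ x → ∀ t, 0 ≤ t → dist (x t) p < ε) ∧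
  (∃ δ > 0, ∀ x₀, dist x₀ p < δ →
    ∀ x, IsForwardSolution f x₀ x → Tendsto x atTop (𝓝 p))

end Dynamics

/-! ## The nonlinear programming problem -/

/-- The data of the problem `min θ(x)` subject to `h_i(x) = 0` for `i = 1, …, m` and
`g_j(x) ≤ 0` for `j = 1, …, k`, with `x ∈ ℝⁿ`. -/
structure NLP (n m k : ℕ) where
  θ : Rn n → ℝ
  h : Fin m → Rn n → ℝ
  g : Fin k → Rn n → ℝ

namespace NLP

noncomputable section

variable {n m k : ℕ} (P : NLP n m k)

/-- The feasible set `S`. -/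
def S : Set (Rn n) := {x | (∀ i, P.h i x = 0) ∧ ∀ j, P.g j x ≤ 0}

/-- The vector `h(x)`. -/
def hVec (x : Rn n) : Fin m → ℝ := fun i => P.h i x

/-- The vector `(g(x))⁺`. -/
def gPos (x : Rn n) : Fin k → ℝ := fun j => max 0 (P.g j x)

/-- The vector `(g(x))⁻`, with the convention `s⁻ = min(0, s)`. -/
def gNeg (x : Rn n) : Fin k → ℝ := fun j => min 0 (P.g j x)

/-- The matrix `A(x)`, whose rows are the gradients of the `h_i`. -/
def A (x : Rn n) : Matrix (Fin m) (Fin n) ℝ := Matrix.of fun i l => gradient (P.h i) x l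

/-- The matrix `B(x)`, whose rows are the gradients of the `g_j`. -/
def B (x : Rn n) : Matrix (Fin k) (Fin n) ℝ := Matrix.of fun j l => gradient (P.g j) x l

/-- `∇θ(x)` as a coordinate vector. -/
def gradθ (x : Rn n) : Fin n → ℝ := fun l => gradient P.θ x l

/-- The set `Φ` of Karush-Kuhn-Tucker points. -/
def Φ : Set (Rn n) :=
  {x | x ∈ P.S ∧ ∃ (lam : Fin m → ℝ) (μ : Fin k → ℝ), (∀ j, 0 ≤ μ j) ∧
    P.gradθ x + (P.A x)ᵀ *ᵥ lam + (P.B x)ᵀ *ᵥ μ = 0 ∧ ∑ j, μ j * P.g j x = 0}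

/-- The penalty function `V(x) = |h(x)|²/2 + |(g(x))⁺|²/2`. -/
def V (x : Rn n) : ℝ := (1 / 2) * ∑ i, P.h i x ^ 2 + (1 / 2) * ∑ j, P.gPos x j ^ 2

/-- `det(A(x)A'(x))`. -/
def dA (x : Rn n) : ℝ := (P.A x * (P.A x)ᵀ).det

/-- `H(x) = det(AA')Iₙ - A' adj(AA') A`. -/
def H (x : Rn n) : Matrix (Fin n) (Fin n) ℝ :=
  P.dA x • (1 : Matrix (Fin n) (Fin n) ℝ) - (P.A x)ᵀ * (P.A x * (P.A x)ᵀ).adjugate * P.A x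

/-- `Q(x) = det(AA') B H B' - det(AA')² diag(g⁻)`. -/
def Q (x : Rn n) : Matrix (Fin k) (Fin k) ℝ :=
  P.dA x • (P.B x * P.H x * (P.B x)ᵀ) - P.dA x ^ 2 • Matrix.diagonal (P.gNeg x)

/-- `R(x) = H B' adj(Q)`. -/
def R (x : Rn n) : Matrix (Fin n) (Fin k) ℝ := P.H x * (P.B x)ᵀ * (P.Q x).adjugate

/-- The vector field `F`:
`det(AA')⁴ R diag(g⁻) R' ∇θ' - det(AA')⁴ R (R'∇θ')⁺`
`  - det(AA') (det(Q) Iₙ - det(AA') R B) H (det(Q) Iₙ - det(AA') B'R') ∇θ'`. -/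
def F (x : Rn n) : Rn n :=
  WithLp.toLp 2
    (P.dA x ^ 4 • ((P.R x * Matrix.diagonal (P.gNeg x) * (P.R x)ᵀ) *ᵥ P.gradθ x)
      - P.dA x ^ 4 • (P.R x *ᵥ fun j => max 0 (((P.R x)ᵀ *ᵥ P.gradθ x) j))
      - P.dA x •
        ((((P.Q x).det • (1 : Matrix (Fin n) (Fin n) ℝ) - P.dA x • (P.R x * P.B x)) * P.H x *
          ((P.Q x).det • (1 : Matrix (Fin n) (Fin n) ℝ) - P.dA x • ((P.B x)ᵀ * (P.R x)ᵀ)))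
            *ᵥ P.gradθ x))

/-- The function
`a = ψ₁ ∇θ F - |∇V|²|∇θ|² - ψ₂ ∇V ∇θ' + |∇V ∇θ'|²`. -/
def a (ψ₁ ψ₂ : Rn n → ℝ) (x : Rn n) : ℝ :=
  ψ₁ x * inner ℝ (gradient P.θ x) (P.F x)
    - ‖gradient P.V x‖ ^ 2 * ‖gradient P.θ x‖ ^ 2
    - ψ₂ x * inner ℝ (gradient P.V x) (gradient P.θ x)
    + |inner ℝ (gradient P.V x) (gradient P.θ x)| ^ 2

/-- The vector field `f = σψ₁F - σ(ψ₂∇V' + (|∇V|²Iₙ - ∇V'∇V)∇θ')`; since `∇V` is a row vector,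
`(∇V'∇V)∇θ'` is `⟨∇V, ∇θ⟩ ∇V'`. -/
def f (σ ψ₁ ψ₂ : Rn n → ℝ) (x : Rn n) : Rn n :=
  (σ x * ψ₁ x) • P.F x
    - σ x • (ψ₂ x • gradient P.V x
      + (‖gradient P.V x‖ ^ 2 • gradient P.θ x
        - (inner ℝ (gradient P.V x) (gradient P.θ x) : ℝ) • gradient P.V x))

/-- The compactness condition. -/
def SublevelCompact : Prop :=
  ∀ z y, P.V y ≤ P.V z → IsCompact {x | P.V x ≤ P.V z ∧ P.θ x ≤ P.θ y}

/-- The linear independence constraint qualification on the feasible set: the gradients of all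
equality constraints and of all active inequality constraints are linearly independent. -/
def LICQ : Prop :=
  ∀ x ∈ P.S, LinearIndependent ℝ
    (Sum.elim (fun i : Fin m => gradient (P.h i) x)
      (fun j : {j : Fin k // P.g j x = 0} => gradient (P.g j) x))

/-- No critical points of the penalty function outside the feasible set. -/
def NoInfeasibleCritical : Prop :=
  ∀ x, (P.A x)ᵀ *ᵥ P.hVec x + (P.B x)ᵀ *ᵥ P.gPos x = 0 → P.hVec x = 0 ∧ P.gPos x = 0

/-- The sublevel-inclusion condition for given `ψ₁, ψ₂`. -/
def SublevelInclusion (ψ₁ ψ₂ : Rn n → ℝ) : Prop :=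
  ∀ z, ∃ y, P.V y ≤ P.V z ∧ P.θ z ≤ P.θ y ∧
    {x | 0 < P.a ψ₁ ψ₂ x ∧ P.V x ≤ P.V z} ⊆ {x | P.θ x ≤ P.θ y}

/-- `p` is a strict local minimum of the problem. -/
def IsStrictLocalMinimum (p : Rn n) : Prop :=
  p ∈ P.S ∧ ∃ ε > 0, ∀ x ∈ P.S, x ≠ p → dist x p < ε → P.θ p < P.θ x

/-- `p` is an isolated KKT point. -/
def IsIsolatedKKT (p : Rn n) : Prop :=
  p ∈ P.Φ ∧ ∃ ε > 0, ∀ x ∈ P.Φ, dist x p < ε → x = p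

end

end NLP

/-! Along a solution V' = σψ₁∇V F − σψ₂|∇V|², because the vector |∇V|²∇θ' − ⟨∇V, ∇θ⟩∇V' is
orthogonal to ∇V. The algebra of H, Q and R gives AF = 0 and (g⁺)'BF ≤ 0, so ∇V F ≤ 0
(`inner_gradient_V_F_nonpos`) and V does not increase. Likewise −∇θ F is a sum of three nonnegative
terms (`gradθ_dotProduct_F`), while θ' = σa. By (A4), θ cannot rise above θ(y) as long as V ≤ V(x₀),
so (A1) traps the solution in a compact set (`exists_trapped`). This gives global existence and the
topological properties of the limit set.

On the limit set V is constant; hence ∇V = 0 there, and (A3) puts the limit set inside S. The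
function θ need not be monotone along the solution. But LICQ yields cV ≤ |∇V|² near S
(`exists_mul_V_le`), so V decays exponentially there, and θ' is at most K√V. Integration gives
θ(x(t)) ≤ θ(x(s)) + M√V(x(s)) for late times s ≤ t (`exists_θ_le_of_tame`), and therefore θ is
constant on the limit set too. On S this means ∇θ F = 0; the vanishing of its three terms is
complementarity, sign condition and stationarity, that is, KKT (`LICQ.mem_Φ_of_dotProduct_eq_zero`).
The same reasoning applies at an equilibrium, with converse `LICQ.F_eq_zero_of_mem_Φ`.

For stability, max(V, θ − θ(p)) has a positive lower bound on small spheres around a strict local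
minimum p, and the two estimates above keep solutions that start near p below that bound
(`exists_forall_dist_lt`). Isolation then leaves p as the only possible limit point. -/

namespace NLP

/-! ### Algebra of H, Q, R and the signs of ∇V F and ∇θ F -/

variable {n m k : ℕ} (P : NLP n m k) (x : Rn n)

lemma A_mul_H : P.A x * P.H x = 0 := by
  have h : P.A x * (P.A x)ᵀ * (P.A x * (P.A x)ᵀ).adjugate = P.dA x • 1 := mul_adjugate _
  rw [H, Matrix.mul_sub, Matrix.mul_smul, Matrix.mul_one, ← Matrix.mul_assoc, ← Matrix.mul_assoc, h,
    Matrix.smul_mul, Matrix.one_mul, sub_self]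

lemma H_transpose : (P.H x)ᵀ = P.H x := by
  simp [H, Matrix.transpose_mul, adjugate_transpose, Matrix.mul_assoc]

lemma H_mul_transpose_A : P.H x * (P.A x)ᵀ = 0 := by
  rw [← P.H_transpose, ← Matrix.transpose_mul, A_mul_H, Matrix.transpose_zero]

/-- For d = det(AA') ≠ 0, H is d times the orthogonal projection onto ker A; this division-free form
survives where d = 0. -/
lemma H_mul_H : P.H x * P.H x = P.dA x • P.H x := by
  conv_lhs => enter [1]; rw [H]
  rw [Matrix.sub_mul, Matrix.smul_mul, Matrix.one_mul, Matrix.mul_assoc, A_mul_H,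
    Matrix.mul_zero, sub_zero]

lemma dA_nonneg : 0 ≤ P.dA x := by
  have := (posSemidef_self_mul_conjTranspose (P.A x)).det_nonneg
  rwa [conjTranspose_eq_transpose_of_trivial] at this

lemma dA_mul_dotProduct_H (v : Fin n → ℝ) :
    P.dA x * (v ⬝ᵥ P.H x *ᵥ v) = (P.H x *ᵥ v) ⬝ᵥ (P.H x *ᵥ v) := by
  have h : P.dA x * (v ⬝ᵥ P.H x *ᵥ v) = v ⬝ᵥ (P.dA x • P.H x) *ᵥ v := by
    rw [smul_mulVec, dotProduct_smul, smul_eq_mul]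
  rw [h, ← H_mul_H, ← mulVec_mulVec, dotProduct_mulVec, ← mulVec_transpose, H_transpose]

/-- Symmetry and H² = dH give d v'Hv = |Hv|². Keeping the factor d in the hypothesis covers the case
d = 0. -/
lemma H_mulVec_eq_zero_of_dA_mul {v : Fin n → ℝ} (h : P.dA x * (v ⬝ᵥ P.H x *ᵥ v) = 0) :
    P.H x *ᵥ v = 0 := by
  rw [dA_mul_dotProduct_H] at h
  exact dotProduct_self_eq_zero.1 h

lemma dotProduct_H_nonneg (v : Fin n → ℝ) : 0 ≤ v ⬝ᵥ P.H x *ᵥ v := by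
  have hd := P.dA_nonneg x
  have h := P.dA_mul_dotProduct_H x v
  have h0 : 0 ≤ (P.H x *ᵥ v) ⬝ᵥ (P.H x *ᵥ v) :=
    Finset.sum_nonneg fun i _ => mul_self_nonneg _
  rcases hd.eq_or_lt with hd | hd
  · rw [P.H_mulVec_eq_zero_of_dA_mul x (v := v) (by rw [← hd, zero_mul]), dotProduct_zero]
  · exact nonneg_of_mul_nonneg_right (h ▸ h0) hd

lemma Q_transpose : (P.Q x)ᵀ = P.Q x := by
  simp [Q, Matrix.transpose_mul, H_transpose, Matrix.mul_assoc]

lemma gNeg_nonpos (j : Fin k) : P.gNeg x j ≤ 0 := min_le_left _ _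

lemma gPos_nonneg (j : Fin k) : 0 ≤ P.gPos x j := le_max_left _ _

lemma gPos_mul_gNeg (j : Fin k) : P.gPos x j * P.gNeg x j = 0 := by
  rcases le_total (P.g j x) 0 with h | h <;> simp [gPos, gNeg, h]

lemma dotProduct_diagonal_mulVec (γ y : Fin k → ℝ) :
    y ⬝ᵥ Matrix.diagonal γ *ᵥ y = ∑ j, γ j * y j ^ 2 := by
  simp only [dotProduct, mulVec_diagonal]
  exact Finset.sum_congr rfl fun j _ => by ring

lemma dotProduct_Q (y : Fin k → ℝ) :
    y ⬝ᵥ P.Q x *ᵥ y = P.dA x * (((P.B x)ᵀ *ᵥ y) ⬝ᵥ P.H x *ᵥ ((P.B x)ᵀ *ᵥ y))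
      + P.dA x ^ 2 * ∑ j, (-P.gNeg x j) * y j ^ 2 := by
  have h : y ⬝ᵥ (P.B x * P.H x * (P.B x)ᵀ) *ᵥ y
      = ((P.B x)ᵀ *ᵥ y) ⬝ᵥ P.H x *ᵥ ((P.B x)ᵀ *ᵥ y) := by
    rw [← mulVec_mulVec, ← mulVec_mulVec, dotProduct_mulVec, ← mulVec_transpose]
  rw [Q, sub_mulVec, dotProduct_sub, smul_mulVec, smul_mulVec, dotProduct_smul, dotProduct_smul, h,
    dotProduct_diagonal_mulVec, smul_eq_mul, smul_eq_mul]
  simp only [neg_mul, Finset.sum_neg_distrib]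
  ring

lemma sum_neg_gNeg_nonneg (y : Fin k → ℝ) : 0 ≤ ∑ j, (-P.gNeg x j) * y j ^ 2 :=
  Finset.sum_nonneg fun j _ => mul_nonneg (neg_nonneg.2 (P.gNeg_nonpos x j)) (sq_nonneg _)

/-- Q is positive semidefinite everywhere, as H and −diag(g⁻) are; the sign is needed off S as well.
-/
lemma det_Q_nonneg : 0 ≤ (P.Q x).det := by
  refine PosSemidef.det_nonneg (posSemidef_iff_dotProduct_mulVec.2 ⟨?_, fun y => ?_⟩)
  · rw [IsHermitian, conjTranspose_eq_transpose_of_trivial, Q_transpose]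
  · rw [star_trivial, dotProduct_Q]
    have := P.dA_nonneg x
    have := P.dotProduct_H_nonneg x ((P.B x)ᵀ *ᵥ y)
    have := P.sum_neg_gNeg_nonneg x y
    positivity

lemma dA_smul_B_H_B : P.dA x • (P.B x * P.H x * (P.B x)ᵀ)
    = P.Q x + P.dA x ^ 2 • Matrix.diagonal (P.gNeg x) := by
  rw [Q, sub_add_cancel]

/-- Here dBHB' = Q + d² diag(g⁻) meets Q adj(Q) = det(Q) I. The remaining diagonal term is killed by
g⁺ from the left, since g⁺ and g⁻ have disjoint supports. -/
lemma dA_smul_B_mul_R : P.dA x • (P.B x * P.R x)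
    = (P.Q x).det • (1 : Matrix (Fin k) (Fin k) ℝ)
      + P.dA x ^ 2 • (Matrix.diagonal (P.gNeg x) * (P.Q x).adjugate) := by
  rw [R, ← Matrix.mul_assoc, ← Matrix.mul_assoc, ← Matrix.smul_mul, dA_smul_B_H_B, Matrix.add_mul,
    mul_adjugate, Matrix.smul_mul]

lemma A_mul_R : P.A x * P.R x = 0 := by
  rw [R, ← Matrix.mul_assoc, ← Matrix.mul_assoc, A_mul_H, Matrix.zero_mul, Matrix.zero_mul]

lemma gPos_vecMul_diagonal : P.gPos x ᵥ* Matrix.diagonal (P.gNeg x) = 0 := by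
  ext j
  simp [vecMul_diagonal, gPos_mul_gNeg]

lemma gPos_vecMul_B_mul_R : P.dA x • (P.gPos x ᵥ* (P.B x * P.R x)) = (P.Q x).det • P.gPos x := by
  rw [← vecMul_smul, dA_smul_B_mul_R, vecMul_add, vecMul_smul, vecMul_smul, ← vecMul_vecMul,
    gPos_vecMul_diagonal, zero_vecMul, smul_zero, add_zero, vecMul_one]

/-- The vector `R'∇θ'`, a multiple of a vector of Lagrange multipliers. -/
noncomputable def w : Fin k → ℝ := (P.R x)ᵀ *ᵥ P.gradθ x

/-- The vector `(det(Q) Iₙ - det(AA') B'R')∇θ'`. -/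
noncomputable def residual : Fin n → ℝ :=
  (P.Q x).det • P.gradθ x - P.dA x • ((P.B x)ᵀ *ᵥ P.w x)

lemma F_eq : (P.F x).ofLp =
    P.dA x ^ 4 • (P.R x *ᵥ (Matrix.diagonal (P.gNeg x) *ᵥ P.w x))
      - P.dA x ^ 4 • (P.R x *ᵥ fun j => max 0 (P.w x j))
      - P.dA x • ((P.Q x).det • (P.H x *ᵥ P.residual x)
          - P.dA x • (P.R x *ᵥ (P.B x *ᵥ (P.H x *ᵥ P.residual x)))) := by
  simp only [F, w, residual, ← mulVec_mulVec, sub_mulVec, smul_mulVec, one_mulVec, mulVec_sub,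
    mulVec_smul]
  module

lemma A_mulVec_F : P.A x *ᵥ (P.F x).ofLp = 0 := by
  simp only [F_eq, mulVec_sub, mulVec_smul, mulVec_mulVec, ← Matrix.mul_assoc, A_mul_R, A_mul_H,
    Matrix.zero_mul, zero_mulVec, smul_zero, sub_zero]

/-- Since g⁺ is a left eigenvector of dBR with eigenvalue det(Q), the first term of F contributes
nothing and the two halves of the last one cancel; only the w⁺ term survives. -/
lemma gPos_dotProduct_B_mulVec_F : P.gPos x ⬝ᵥ (P.B x *ᵥ (P.F x).ofLp)
    = -(P.dA x ^ 3 * (P.Q x).det * ∑ j, P.gPos x j * max 0 (P.w x j)) := by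
  have key (z : Fin k → ℝ) : P.dA x * (P.gPos x ⬝ᵥ (P.B x *ᵥ (P.R x *ᵥ z)))
      = (P.Q x).det * (P.gPos x ⬝ᵥ z) := by
    rw [mulVec_mulVec, dotProduct_mulVec, ← smul_eq_mul, ← smul_dotProduct, gPos_vecMul_B_mul_R,
      smul_dotProduct, smul_eq_mul]
  have k1 := key (Matrix.diagonal (P.gNeg x) *ᵥ P.w x)
  rw [dotProduct_mulVec (P.gPos x) (Matrix.diagonal _), gPos_vecMul_diagonal, zero_dotProduct,
    mul_zero] at k1
  have k2 := key fun j => max 0 (P.w x j)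
  have k3 := key (P.B x *ᵥ (P.H x *ᵥ P.residual x))
  simp only [F_eq, mulVec_sub, mulVec_smul, dotProduct_sub, dotProduct_smul, smul_eq_mul]
  change _ = -(P.dA x ^ 3 * (P.Q x).det * (P.gPos x ⬝ᵥ fun j => max 0 (P.w x j)))
  linear_combination P.dA x ^ 3 * k1 - P.dA x ^ 3 * k2 + P.dA x * k3

/-- Because ∇θ R = w', the last term of F becomes the quadratic form of H at the residual, and the
other two become sums of squares with nonnegative weights. -/
lemma gradθ_dotProduct_F : P.gradθ x ⬝ᵥ (P.F x).ofLp =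
    -(P.dA x ^ 4 * ∑ j, (-P.gNeg x j) * P.w x j ^ 2 + P.dA x ^ 4 * ∑ j, max 0 (P.w x j) ^ 2
      + P.dA x * (P.residual x ⬝ᵥ P.H x *ᵥ P.residual x)) := by
  have key (z : Fin k → ℝ) : P.gradθ x ⬝ᵥ (P.R x *ᵥ z) = P.w x ⬝ᵥ z := by
    rw [dotProduct_mulVec, w, mulVec_transpose]
  have hw : (P.w x ⬝ᵥ fun j => max 0 (P.w x j)) = ∑ j, max 0 (P.w x j) ^ 2 := by
    refine Finset.sum_congr rfl fun j _ => ?_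
    rcases le_total (P.w x j) 0 with h | h <;> simp [h, sq]
  have hB (z : Fin n → ℝ) : P.w x ⬝ᵥ (P.B x *ᵥ z) = ((P.B x)ᵀ *ᵥ P.w x) ⬝ᵥ z := by
    rw [dotProduct_mulVec, mulVec_transpose]
  have hres : P.residual x ⬝ᵥ P.H x *ᵥ P.residual x
      = (P.Q x).det * (P.gradθ x ⬝ᵥ P.H x *ᵥ P.residual x)
        - P.dA x * (((P.B x)ᵀ *ᵥ P.w x) ⬝ᵥ P.H x *ᵥ P.residual x) := by
    conv_lhs => enter [1]; rw [residual]
    rw [sub_dotProduct, smul_dotProduct, smul_dotProduct, smul_eq_mul, smul_eq_mul]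
  rw [hres]
  simp only [F_eq, dotProduct_sub, dotProduct_smul, smul_eq_mul, key, dotProduct_diagonal_mulVec,
    hw, hB, neg_mul, Finset.sum_neg_distrib]
  ring

lemma gradθ_dotProduct_F_nonpos : P.gradθ x ⬝ᵥ (P.F x).ofLp ≤ 0 := by
  rw [gradθ_dotProduct_F, neg_nonpos]
  have := P.dA_nonneg x
  have := P.dotProduct_H_nonneg x (P.residual x)
  have := P.sum_neg_gNeg_nonneg x (P.w x)
  positivity

/-! ### Consequences of LICQ on the feasible set: zeros of F and KKT points -/

variable {P x}

lemma LICQ.eq_zero (hP : P.LICQ) (hx : x ∈ P.S) {c : Fin m → ℝ} {b : Fin k → ℝ}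
    (hb : ∀ j, P.g j x ≠ 0 → b j = 0) (h : (P.A x)ᵀ *ᵥ c + (P.B x)ᵀ *ᵥ b = 0) :
    c = 0 ∧ b = 0 := by
  classical
  have hli := Fintype.linearIndependent_iff.1 (hP x hx) (Sum.elim c fun j => b j) (by
    rw [Fintype.sum_sum_type]
    simp only [Sum.elim_inl, Sum.elim_inr]
    have hs : ∑ j : {j : Fin k // P.g j x = 0}, b j • gradient (P.g j) x
        = ∑ j, b j • gradient (P.g j) x := by
      rw [← Fintype.sum_subtype_add_sum_subtype (fun j => P.g j x = 0), left_eq_add]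
      exact Finset.sum_eq_zero fun j _ => by rw [hb j j.2, zero_smul]
    rw [hs]
    ext l
    have := congrFun h l
    simpa [mulVec, dotProduct, A, B, mul_comm] using this)
  refine ⟨funext fun i => hli (Sum.inl i), funext fun j => ?_⟩
  by_cases hj : P.g j x = 0
  · exact hli (Sum.inr ⟨j, hj⟩)
  · exact hb j hj

lemma LICQ.dA_pos (hP : P.LICQ) (hx : x ∈ P.S) : 0 < P.dA x := by
  have h : (P.A x * (P.A x)ᴴ).PosDef := PosDef.mul_conjTranspose_self _ (by
    refine (injective_iff_map_eq_zero (P.A x).vecMulLinear).2 fun c hc => ?_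
    refine (hP.eq_zero hx (c := c) (b := 0) (fun _ _ => rfl) ?_).1
    rw [mulVec_zero, add_zero, mulVec_transpose]
    exact hc)
  rw [conjTranspose_eq_transpose_of_trivial] at h
  exact h.det_pos

lemma exists_of_H_mulVec_eq_zero (hd : P.dA x ≠ 0) {v : Fin n → ℝ} (hv : P.H x *ᵥ v = 0) :
    ∃ c, v = (P.A x)ᵀ *ᵥ c := by
  refine ⟨(P.dA x)⁻¹ • ((P.A x * (P.A x)ᵀ).adjugate *ᵥ (P.A x *ᵥ v)), ?_⟩
  rw [H, sub_mulVec, smul_mulVec, one_mulVec, ← mulVec_mulVec, ← mulVec_mulVec, sub_eq_zero] at hv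
  rw [mulVec_smul, ← hv, smul_smul, inv_mul_cancel₀ hd, one_smul]

lemma gNeg_of_mem_S (hx : x ∈ P.S) (j : Fin k) : P.gNeg x j = P.g j x := min_eq_right (hx.2 j)

/-- If y'Qy = 0, then y vanishes on the inactive constraints and HB'y = 0, so B'y lies in the range
of A'; LICQ forces y = 0. -/
lemma LICQ.det_Q_pos (hP : P.LICQ) (hx : x ∈ P.S) : 0 < (P.Q x).det := by
  have hd := hP.dA_pos hx
  refine PosDef.det_pos (posDef_iff_dotProduct_mulVec.2 ⟨?_, fun y hy => ?_⟩)
  · rw [IsHermitian, conjTranspose_eq_transpose_of_trivial, Q_transpose]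
  rw [star_trivial]
  have h1 := P.dotProduct_H_nonneg x ((P.B x)ᵀ *ᵥ y)
  have h2 := P.sum_neg_gNeg_nonneg x y
  rcases (show 0 ≤ y ⬝ᵥ P.Q x *ᵥ y by rw [dotProduct_Q]; positivity).eq_or_lt with h | h
  swap
  · exact h
  exfalso
  rw [dotProduct_Q] at h
  have e1 : P.dA x * (((P.B x)ᵀ *ᵥ y) ⬝ᵥ P.H x *ᵥ ((P.B x)ᵀ *ᵥ y)) = 0 :=
    le_antisymm (by nlinarith [mul_nonneg (sq_nonneg (P.dA x)) h2]) (by positivity)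
  have e2 : ∑ j, (-P.gNeg x j) * y j ^ 2 = 0 := by
    rw [e1, zero_add] at h
    exact (mul_eq_zero.1 h.symm).resolve_left (by positivity)
  obtain ⟨c, hc⟩ := exists_of_H_mulVec_eq_zero hd.ne' (P.H_mulVec_eq_zero_of_dA_mul x e1)
  refine hy (hP.eq_zero hx (c := -c) (b := y) (fun j hj => ?_) ?_).2
  · have := (Finset.sum_eq_zero_iff_of_nonneg fun j _ =>
      mul_nonneg (neg_nonneg.2 (P.gNeg_nonpos x j)) (sq_nonneg (y j))).1 e2 j (Finset.mem_univ j)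
    rw [gNeg_of_mem_S hx] at this
    simpa [hj] using this
  · rw [hc, mulVec_neg, neg_add_cancel]

lemma LICQ.mem_Φ_of_dotProduct_eq_zero (hP : P.LICQ) (hx : x ∈ P.S)
    (h : P.gradθ x ⬝ᵥ (P.F x).ofLp = 0) : x ∈ P.Φ := by
  have hd := hP.dA_pos hx
  have hq := hP.det_Q_pos hx
  have h1 := P.dotProduct_H_nonneg x (P.residual x)
  have h2 := P.sum_neg_gNeg_nonneg x (P.w x)
  have h3 : 0 ≤ ∑ j, max 0 (P.w x j) ^ 2 := by positivity
  rw [gradθ_dotProduct_F, neg_eq_zero] at h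
  have k1 := mul_nonneg hd.le h1
  have k2 := mul_nonneg (pow_pos hd 4).le h2
  have k3 := mul_nonneg (pow_pos hd 4).le h3
  have e1 : P.dA x * (P.residual x ⬝ᵥ P.H x *ᵥ P.residual x) = 0 := by linarith
  have e2 := (mul_eq_zero.1 (show P.dA x ^ 4 * ∑ j, (-P.gNeg x j) * P.w x j ^ 2 = 0 by
    linarith)).resolve_left (by positivity)
  have e3 := (mul_eq_zero.1 (show P.dA x ^ 4 * ∑ j, max 0 (P.w x j) ^ 2 = 0 by
    linarith)).resolve_left (by positivity)
  have hg (j : Fin k) : P.g j x * P.w x j = 0 := by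
    have := (Finset.sum_eq_zero_iff_of_nonneg fun j _ =>
      mul_nonneg (neg_nonneg.2 (P.gNeg_nonpos x j)) (sq_nonneg (P.w x j))).1 e2 j
        (Finset.mem_univ j)
    rw [gNeg_of_mem_S hx] at this
    simpa using this
  have hw (j : Fin k) : P.w x j ≤ 0 := by
    have := (Finset.sum_eq_zero_iff_of_nonneg fun j _ =>
      sq_nonneg (max 0 (P.w x j))).1 e3 j (Finset.mem_univ j)
    simpa using this
  obtain ⟨c, hc⟩ := exists_of_H_mulVec_eq_zero hd.ne' (P.H_mulVec_eq_zero_of_dA_mul x e1)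
  -- The residual det(Q)∇θ' − dB'w equals A'c; dividing by det(Q) gives the multipliers.
  refine ⟨hx, -((P.Q x).det⁻¹ • c), -(((P.Q x).det⁻¹ * P.dA x) • P.w x), fun j => ?_, ?_, ?_⟩
  · have := hw j
    have : 0 ≤ ((P.Q x).det⁻¹ * P.dA x) * (-P.w x j) :=
      mul_nonneg (by positivity) (neg_nonneg.2 this)
    simpa using this
  · rw [mulVec_neg, mulVec_neg, mulVec_smul, mulVec_smul, ← hc, residual, smul_sub, smul_smul,
      inv_mul_cancel₀ hq.ne', one_smul, smul_smul]
    abel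
  · refine Finset.sum_eq_zero fun j _ => ?_
    simp only [Pi.neg_apply, Pi.smul_apply, smul_eq_mul]
    linear_combination -((P.Q x).det⁻¹ * P.dA x) * hg j

/-- At a KKT point dw = −det(Q)μ: AR = 0 removes λ, and complementarity removes the diagonal part.
So w ≤ 0, diag(g⁻)w = 0, and the residual −det(Q)A'λ is killed by H; every term of F vanishes. -/
lemma LICQ.F_eq_zero_of_mem_Φ (hP : P.LICQ) (hx : x ∈ P.Φ) : P.F x = 0 := by
  obtain ⟨hS, lam, μ, hμ, hkkt, hcompl⟩ := hx
  have hd := hP.dA_pos hS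
  have hq := hP.det_Q_pos hS
  have hg (j : Fin k) : P.g j x * μ j = 0 := by
    have := (Finset.sum_eq_zero_iff_of_nonpos fun j _ =>
      mul_nonpos_of_nonneg_of_nonpos (hμ j) (hS.2 j)).1 hcompl j (Finset.mem_univ j)
    rwa [mul_comm]
  have hu : P.gradθ x = -((P.A x)ᵀ *ᵥ lam) - (P.B x)ᵀ *ᵥ μ := by
    rw [add_assoc] at hkkt
    rw [eq_neg_of_add_eq_zero_left hkkt]
    abel
  have hdw : P.dA x • P.w x = -((P.Q x).det • μ) := by
    have hR : (P.R x)ᵀ = (P.Q x).adjugate * (P.B x * P.H x) := by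
      rw [R, transpose_mul, transpose_mul, transpose_transpose, H_transpose, adjugate_transpose,
        Q_transpose]
    have hA : (P.R x)ᵀ *ᵥ ((P.A x)ᵀ *ᵥ lam) = 0 := by
      rw [mulVec_mulVec, ← transpose_mul, A_mul_R, transpose_zero, zero_mulVec]
    have hD : Matrix.diagonal (P.gNeg x) *ᵥ μ = 0 := by
      ext j
      rw [mulVec_diagonal, gNeg_of_mem_S hS, hg, Pi.zero_apply]
    rw [w, hu, mulVec_sub, mulVec_neg, hA, neg_zero, zero_sub, hR, mulVec_mulVec, Matrix.mul_assoc,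
      smul_neg, ← smul_mulVec, ← Matrix.mul_smul, dA_smul_B_H_B, Matrix.mul_add, adjugate_mul,
      add_mulVec, smul_mulVec, one_mulVec, Matrix.mul_smul, smul_mulVec, ← mulVec_mulVec, hD,
      mulVec_zero, smul_zero, add_zero]
  have hw : P.w x = -(((P.dA x)⁻¹ * (P.Q x).det) • μ) := by
    rw [mul_smul, ← smul_neg, ← hdw, smul_smul, inv_mul_cancel₀ hd.ne', one_smul]
  have hD : Matrix.diagonal (P.gNeg x) *ᵥ P.w x = 0 := by
    ext j
    rw [mulVec_diagonal, gNeg_of_mem_S hS, hw]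
    simp only [Pi.neg_apply, Pi.smul_apply, smul_eq_mul, Pi.zero_apply]
    linear_combination -((P.dA x)⁻¹ * (P.Q x).det) * hg j
  have hmax : (fun j => max 0 (P.w x j)) = 0 := by
    ext j
    rw [hw]
    have := mul_nonneg (mul_pos (inv_pos.2 hd) hq).le (hμ j)
    simpa using this
  have hres : P.H x *ᵥ P.residual x = 0 := by
    rw [residual, ← mulVec_smul, hdw, hu]
    have : (P.Q x).det • (-((P.A x)ᵀ *ᵥ lam) - (P.B x)ᵀ *ᵥ μ) - (P.B x)ᵀ *ᵥ (-((P.Q x).det • μ))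
        = -((P.Q x).det • ((P.A x)ᵀ *ᵥ lam)) := by
      rw [mulVec_neg, mulVec_smul, smul_sub, smul_neg]
      abel
    rw [this, mulVec_neg, mulVec_smul, mulVec_mulVec, H_mul_transpose_A, zero_mulVec, smul_zero,
      neg_zero]
  have := P.F_eq x
  rw [hD, hmax, hres] at this
  simp only [mulVec_zero, smul_zero, sub_zero] at this
  exact (WithLp.ofLp_eq_zero 2).1 this

end NLP

/-! ### Calculus of locally Lipschitz functions -/

section LocallyLipschitz

variable {X : Type*} [PseudoEMetricSpace X]

lemma LocallyLipschitz.fun_add {E : Type*} [SeminormedAddCommGroup E] {f g : X → E}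
    (hf : LocallyLipschitz f) (hg : LocallyLipschitz g) : LocallyLipschitz fun x => f x + g x :=
  hf.add hg

lemma LocallyLipschitz.fun_sub {E : Type*} [SeminormedAddCommGroup E] {f g : X → E}
    (hf : LocallyLipschitz f) (hg : LocallyLipschitz g) : LocallyLipschitz fun x => f x - g x :=
  hf.sub hg

lemma LocallyLipschitz.fun_sum {E ι : Type*} [SeminormedAddCommGroup E] (s : Finset ι)
    {f : ι → X → E} (hf : ∀ i, LocallyLipschitz (f i)) :
    LocallyLipschitz fun x => ∑ i ∈ s, f i x := by
  classical
  induction s using Finset.induction_on with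
  | empty => simpa using LocallyLipschitz.const (0 : E)
  | insert i s hi ih =>
    simp only [Finset.sum_insert hi]
    exact (hf i).fun_add ih

lemma LocallyLipschitz.fun_smul {E : Type*} [NormedAddCommGroup E] [NormedSpace ℝ E]
    {c : X → ℝ} {f : X → E} (hc : LocallyLipschitz c) (hf : LocallyLipschitz f) :
    LocallyLipschitz fun x => c x • f x :=
  LocallyLipschitz.comp (f := fun p : ℝ × E => p.1 • p.2)
    (contDiff_fst.smul contDiff_snd : ContDiff ℝ 1 fun p : ℝ × E => p.1 • p.2).locallyLipschitz
    (hc.prodMk hf)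

lemma LocallyLipschitz.fun_mul {c f : X → ℝ} (hc : LocallyLipschitz c) (hf : LocallyLipschitz f) :
    LocallyLipschitz fun x => c x * f x := hc.fun_smul hf

lemma LocallyLipschitz.fun_pow {c : X → ℝ} (hc : LocallyLipschitz c) (r : ℕ) :
    LocallyLipschitz fun x => c x ^ r := by
  induction r with
  | zero => simpa using LocallyLipschitz.const (1 : ℝ)
  | succ r ih =>
    simp only [pow_succ]
    exact ih.fun_mul hc

lemma LocallyLipschitz.fun_prod {ι : Type*} (s : Finset ι)
    {f : ι → X → ℝ} (hf : ∀ i, LocallyLipschitz (f i)) :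
    LocallyLipschitz fun x => ∏ i ∈ s, f i x := by
  classical
  induction s using Finset.induction_on with
  | empty => simpa using LocallyLipschitz.const (1 : ℝ)
  | insert i s hi ih =>
    simp only [Finset.prod_insert hi]
    exact (hf i).fun_mul ih

lemma LocallyLipschitz.inner {E : Type*} [NormedAddCommGroup E] [InnerProductSpace ℝ E]
    {f g : X → E} (hf : LocallyLipschitz f) (hg : LocallyLipschitz g) :
    LocallyLipschitz fun x => (inner ℝ (f x) (g x) : ℝ) :=
  LocallyLipschitz.comp (f := fun p : E × E => (Inner.inner ℝ p.1 p.2 : ℝ))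
    (contDiff_fst.inner ℝ contDiff_snd :
      ContDiff ℝ 1 fun p : E × E => (Inner.inner ℝ p.1 p.2 : ℝ)).locallyLipschitz
    (hf.prodMk hg)

lemma LocallyLipschitz.toLp {n : ℕ} {v : X → Fin n → ℝ}
    (hv : ∀ l, LocallyLipschitz fun x => v x l) :
    LocallyLipschitz fun x => (WithLp.toLp 2 (v x) : Rn n) := by
  have h (x : X) : (WithLp.toLp 2 (v x) : Rn n)
      = ∑ l, v x l • EuclideanSpace.basisFun (Fin n) ℝ l :=
    ((EuclideanSpace.basisFun (Fin n) ℝ).sum_repr (WithLp.toLp 2 (v x))).symm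
  simp only [h]
  exact LocallyLipschitz.fun_sum _ fun l => (hv l).fun_smul (LocallyLipschitz.const _)

lemma LocallyLipschitz.coord {n : ℕ} {v : X → Rn n} (hv : LocallyLipschitz v) (l : Fin n) :
    LocallyLipschitz fun x => v x l :=
  ((EuclideanSpace.proj l : Rn n →L[ℝ] ℝ).lipschitz.locallyLipschitz).comp hv

/-- A matrix-valued function has locally Lipschitz entries. -/
def LocallyLipschitzEntries {ι κ : Type*} (M : X → Matrix ι κ ℝ) : Prop :=
  ∀ i j, LocallyLipschitz fun x => M x i j

namespace LocallyLipschitzEntries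

variable {ι κ ν : Type*}

lemma transpose {M : X → Matrix ι κ ℝ} (hM : LocallyLipschitzEntries M) :
    LocallyLipschitzEntries fun x => (M x)ᵀ := fun i j => hM j i

lemma mul [Fintype κ] {M : X → Matrix ι κ ℝ} {N : X → Matrix κ ν ℝ}
    (hM : LocallyLipschitzEntries M) (hN : LocallyLipschitzEntries N) :
    LocallyLipschitzEntries fun x => M x * N x := fun i j => by
  simp only [mul_apply]
  exact LocallyLipschitz.fun_sum _ fun l => (hM i l).fun_mul (hN l j)

lemma sub {M N : X → Matrix ι κ ℝ} (hM : LocallyLipschitzEntries M)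
    (hN : LocallyLipschitzEntries N) : LocallyLipschitzEntries fun x => M x - N x :=
  fun i j => (hM i j).fun_sub (hN i j)

lemma smul {c : X → ℝ} {M : X → Matrix ι κ ℝ} (hc : LocallyLipschitz c)
    (hM : LocallyLipschitzEntries M) : LocallyLipschitzEntries fun x => c x • M x :=
  fun i j => hc.fun_mul (hM i j)

lemma const (M : Matrix ι κ ℝ) : LocallyLipschitzEntries fun _ : X => M :=
  fun _ _ => LocallyLipschitz.const _

lemma diagonal [DecidableEq ι] {v : X → ι → ℝ} (hv : ∀ i, LocallyLipschitz fun x => v x i) :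
    LocallyLipschitzEntries fun x => Matrix.diagonal (v x) := fun i j => by
  rcases eq_or_ne i j with rfl | h
  · simpa using hv i
  · simpa [h] using LocallyLipschitz.const (0 : ℝ)

lemma mulVec [Fintype κ] {M : X → Matrix ι κ ℝ} {v : X → κ → ℝ} (hM : LocallyLipschitzEntries M)
    (hv : ∀ i, LocallyLipschitz fun x => v x i) (i : ι) :
    LocallyLipschitz fun x => (M x *ᵥ v x) i := by
  simp only [Matrix.mulVec, dotProduct]
  exact LocallyLipschitz.fun_sum _ fun l => (hM i l).fun_mul (hv l)

lemma det [Fintype ι] [DecidableEq ι] {M : X → Matrix ι ι ℝ} (hM : LocallyLipschitzEntries M) :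
    LocallyLipschitz fun x => (M x).det := by
  simp only [det_apply']
  exact LocallyLipschitz.fun_sum _ fun τ => (LocallyLipschitz.const _).fun_mul
    (LocallyLipschitz.fun_prod _ fun i => hM _ _)

lemma adjugate [Fintype ι] [DecidableEq ι] {M : X → Matrix ι ι ℝ}
    (hM : LocallyLipschitzEntries M) : LocallyLipschitzEntries fun x => (M x).adjugate :=
  fun i j => by
    simp only [adjugate_apply]
    refine det fun a b => ?_
    rcases eq_or_ne a j with rfl | h
    · simpa using LocallyLipschitz.const _
    · simpa [updateRow_ne h] using hM a b

end LocallyLipschitzEntries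

lemma ContDiff.locallyLipschitz_gradient {n : ℕ} {φ : Rn n → ℝ} (hφ : ContDiff ℝ 2 φ) :
    LocallyLipschitz (gradient φ) :=
  ((InnerProductSpace.toDual ℝ (Rn n)).symm.lipschitz.locallyLipschitz).comp
    (hφ.fderiv_right (m := 1) (by norm_num)).locallyLipschitz

end LocallyLipschitz

/-- At 0 the second derivative fails to exist, so V is in general only C¹; the two one-sided
derivatives are glued there. -/
lemma hasDerivAt_max_zero_sq (s : ℝ) :
    HasDerivAt (fun t : ℝ => (1 / 2) * max 0 t ^ 2) (max 0 s) s := by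
  have hsq (t : ℝ) : HasDerivAt (fun t : ℝ => (1 / 2) * t ^ 2) t t := by
    simpa using (hasDerivAt_pow 2 t).const_mul (1 / 2 : ℝ)
  rcases lt_trichotomy s 0 with h | rfl | h
  · rw [max_eq_left h.le]
    refine (hasDerivAt_const s (0 : ℝ)).congr_of_eventuallyEq ?_
    filter_upwards [Iio_mem_nhds h] with t ht
    simp [max_eq_left (le_of_lt (mem_Iio.1 ht))]
  · rw [max_self, ← hasDerivWithinAt_univ, ← Iic_union_Ici (a := (0 : ℝ))]
    refine HasDerivWithinAt.union ?_ ?_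
    · exact (hasDerivAt_const (0 : ℝ) (0 : ℝ)).hasDerivWithinAt.congr
        (fun t ht => by simp [max_eq_left (mem_Iic.1 ht)]) (by simp)
    · exact (hsq 0).hasDerivWithinAt.congr
        (fun t ht => by simp [max_eq_right (mem_Ici.1 ht)]) (by simp)
  · rw [max_eq_right h.le]
    refine (hsq s).congr_of_eventuallyEq ?_
    filter_upwards [Ioi_mem_nhds h] with t ht
    simp [max_eq_right (le_of_lt (mem_Ioi.1 ht))]

/-! ### Gradient of V and local Lipschitz continuity of F and f -/

namespace NLP

variable {n m k : ℕ} {P : NLP n m k}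

lemma hasGradientAt_V (hh : ∀ i, ContDiff ℝ 2 (P.h i)) (hg : ∀ j, ContDiff ℝ 2 (P.g j))
    (x : Rn n) : HasGradientAt P.V
      (∑ i, P.h i x • gradient (P.h i) x + ∑ j, P.gPos x j • gradient (P.g j) x) x := by
  have e1 (i : Fin m) := ((hh i).differentiable (by norm_num) x).hasGradientAt
  have e2 (j : Fin k) := ((hg j).differentiable (by norm_num) x).hasGradientAt
  simp only [hasGradientAt_iff_hasFDerivAt] at e1 e2 ⊢
  have d1 := HasFDerivAt.fun_sum fun i (_ : i ∈ Finset.univ) =>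
    ((e1 i).pow 2).const_mul (1 / 2 : ℝ)
  have d2 := HasFDerivAt.fun_sum fun j (_ : j ∈ Finset.univ) =>
    (hasDerivAt_max_zero_sq (P.g j x)).comp_hasFDerivAt x (e2 j)
  have hV : P.V = fun x => ∑ i, (1 / 2) * P.h i x ^ 2 + ∑ j, (1 / 2) * max 0 (P.g j x) ^ 2 := by
    funext x
    simp only [V, Finset.mul_sum, gPos]
  rw [hV]
  refine (d1.fun_add d2).congr_fderiv ?_
  simp only [map_add, map_sum, map_smul]
  congr 1
  refine Finset.sum_congr rfl fun i _ => ?_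
  ext y
  simp
  ring

lemma gradient_V (hh : ∀ i, ContDiff ℝ 2 (P.h i)) (hg : ∀ j, ContDiff ℝ 2 (P.g j)) (x : Rn n) :
    gradient P.V x =
    ∑ i, P.h i x • gradient (P.h i) x + ∑ j, P.gPos x j • gradient (P.g j) x :=
  (hasGradientAt_V hh hg x).gradient

lemma locallyLipschitz_gPos (hg : ∀ j, ContDiff ℝ 2 (P.g j)) (j : Fin k) :
    LocallyLipschitz fun x => P.gPos x j :=
  ((hg j).of_le (by norm_num)).locallyLipschitz.const_max 0

lemma locallyLipschitz_gradient_V (hh : ∀ i, ContDiff ℝ 2 (P.h i))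
    (hg : ∀ j, ContDiff ℝ 2 (P.g j)) : LocallyLipschitz (gradient P.V) := by
  rw [funext (gradient_V hh hg)]
  exact (LocallyLipschitz.fun_sum _ fun i => ((hh i).of_le (by norm_num)).locallyLipschitz.fun_smul
      (hh i).locallyLipschitz_gradient).fun_add
    (LocallyLipschitz.fun_sum _ fun j =>
      (locallyLipschitz_gPos hg j).fun_smul (hg j).locallyLipschitz_gradient)

lemma ofLp_gradient_V (hh : ∀ i, ContDiff ℝ 2 (P.h i)) (hg : ∀ j, ContDiff ℝ 2 (P.g j))
    (x : Rn n) : (gradient P.V x).ofLp = (P.A x)ᵀ *ᵥ P.hVec x + (P.B x)ᵀ *ᵥ P.gPos x := by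
  rw [gradient_V hh hg]
  ext l
  simp [Matrix.mulVec, dotProduct, A, B, hVec, mul_comm]

lemma locallyLipschitz_F (hθ : ContDiff ℝ 2 P.θ) (hh : ∀ i, ContDiff ℝ 2 (P.h i))
    (hg : ∀ j, ContDiff ℝ 2 (P.g j)) : LocallyLipschitz P.F := by
  have lA : LocallyLipschitzEntries P.A := fun i => (hh i).locallyLipschitz_gradient.coord
  have lB : LocallyLipschitzEntries P.B := fun j => (hg j).locallyLipschitz_gradient.coord
  have lu : ∀ l, LocallyLipschitz fun x => P.gradθ x l := hθ.locallyLipschitz_gradient.coord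
  have lγ : LocallyLipschitzEntries fun x => Matrix.diagonal (P.gNeg x) :=
    .diagonal fun j => ((hg j).of_le (by norm_num)).locallyLipschitz.const_min 0
  have ld : LocallyLipschitz P.dA := (lA.mul lA.transpose).det
  have lH : LocallyLipschitzEntries P.H :=
    (LocallyLipschitzEntries.smul ld (.const 1)).sub
      ((lA.transpose.mul (lA.mul lA.transpose).adjugate).mul lA)
  have lQ : LocallyLipschitzEntries P.Q :=
    (LocallyLipschitzEntries.smul ld ((lB.mul lH).mul lB.transpose)).sub
      (LocallyLipschitzEntries.smul (ld.fun_pow 2) lγ)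
  have lR : LocallyLipschitzEntries P.R := (lH.mul lB.transpose).mul lQ.adjugate
  have lq := LocallyLipschitzEntries.smul lQ.det (.const (1 : Matrix (Fin n) (Fin n) ℝ))
  refine LocallyLipschitz.toLp fun l => (LocallyLipschitz.fun_sub ?_ ?_).fun_sub ?_
  · exact (ld.fun_pow 4).fun_mul (((lR.mul lγ).mul lR.transpose).mulVec lu l)
  · exact (ld.fun_pow 4).fun_mul
      (lR.mulVec (fun j => (lR.transpose.mulVec lu j).const_max 0) l)
  · exact ld.fun_mul ((((lq.sub (.smul ld (lR.mul lB))).mul lH).mul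
      (lq.sub (.smul ld (lB.transpose.mul lR.transpose)))).mulVec lu l)

lemma locallyLipschitz_f (hθ : ContDiff ℝ 2 P.θ) (hh : ∀ i, ContDiff ℝ 2 (P.h i))
    (hg : ∀ j, ContDiff ℝ 2 (P.g j)) {σ ψ₁ ψ₂ : Rn n → ℝ} (hψ₁ : LocallyLipschitz ψ₁)
    (hψ₂ : LocallyLipschitz ψ₂) (hσ : LocallyLipschitz σ) :
    LocallyLipschitz (P.f σ ψ₁ ψ₂) := by
  have lV := locallyLipschitz_gradient_V hh hg
  have lu := hθ.locallyLipschitz_gradient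
  have hn : LocallyLipschitz fun x => ‖gradient P.V x‖ ^ 2 := by
    simp only [← real_inner_self_eq_norm_sq]
    exact lV.inner lV
  exact ((hσ.fun_mul hψ₁).fun_smul (locallyLipschitz_F hθ hh hg)).fun_sub
    (hσ.fun_smul ((hψ₂.fun_smul lV).fun_add ((hn.fun_smul lu).fun_sub
      ((lV.inner lu).fun_smul lV))))

end NLP

/-! ### Truncation of vector fields -/

section Truncation

variable {n : ℕ}

/-- The componentwise projection of `ℝⁿ` onto the cube `[-r, r]ⁿ`. -/
noncomputable def cubeProj (r : ℝ) (x : Rn n) : Rn n :=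
  WithLp.toLp 2 fun i => max (-r) (min r (x i))

lemma lipschitzWith_cubeProj (r : ℝ) : LipschitzWith 1 (cubeProj r : Rn n → Rn n) := by
  refine LipschitzWith.of_dist_le_mul fun x y => ?_
  rw [NNReal.coe_one, one_mul, EuclideanSpace.dist_eq, EuclideanSpace.dist_eq]
  refine Real.sqrt_le_sqrt (Finset.sum_le_sum fun i _ => ?_)
  refine pow_le_pow_left₀ dist_nonneg ?_ 2
  have h := ((LipschitzWith.id (α := ℝ)).const_min r).const_max (-r)
  simpa [cubeProj] using h.dist_le_mul (x i) (y i)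

lemma cubeProj_of_norm_le {r : ℝ} {x : Rn n} (hx : ‖x‖ ≤ r) : cubeProj r x = x := by
  ext i
  have := abs_le.1 ((PiLp.norm_apply_le x i).trans hx)
  simp [cubeProj, this.1, this.2]

lemma isBounded_range_cubeProj (r : ℝ) :
    Bornology.IsBounded (range (cubeProj r : Rn n → Rn n)) := by
  refine isBounded_iff_forall_norm_le.2 ⟨∑ _i : Fin n, |r|, ?_⟩
  rintro _ ⟨x, rfl⟩
  have h : cubeProj r x = ∑ i, (cubeProj r x) i • EuclideanSpace.basisFun (Fin n) ℝ i :=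
    ((EuclideanSpace.basisFun (Fin n) ℝ).sum_repr _).symm
  rw [h]
  refine (norm_sum_le _ _).trans (Finset.sum_le_sum fun i _ => ?_)
  rw [norm_smul, (EuclideanSpace.basisFun (Fin n) ℝ).orthonormal.1 i, mul_one, Real.norm_eq_abs,
    abs_le]
  simp only [cubeProj]
  refine ⟨?_, max_le (neg_le_abs r) ((min_le_left _ _).trans (le_abs_self r))⟩
  rcases le_total 0 r with h | h
  · rw [abs_of_nonneg h]
    exact le_max_left _ _
  · exact (neg_nonpos.2 (abs_nonneg r)).trans ((neg_nonneg.2 h).trans (le_max_left _ _))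

/-- A locally Lipschitz vector field agrees on a given ball with a bounded Lipschitz one. -/
lemma LocallyLipschitz.exists_truncation {f : Rn n → Rn n} (hf : LocallyLipschitz f) (r : ℝ) :
    ∃ (v : Rn n → Rn n) (K L : NNReal), LipschitzWith K v ∧ (∀ x, ‖v x‖ ≤ L) ∧
      ∀ x, ‖x‖ ≤ r → v x = f x := by
  -- The truncation is f composed with the cube projection; on this compact set f is Lipschitz and
  -- bounded.
  have hc : IsCompact (closure (range (cubeProj r : Rn n → Rn n))) :=
    (isBounded_range_cubeProj r).isCompact_closure
  obtain ⟨K, hK⟩ := (hf.locallyLipschitzOn).exists_lipschitzOnWith_of_compact hc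
  obtain ⟨L, hL⟩ := hc.exists_bound_of_continuousOn hf.continuous.continuousOn
  have hm (x : Rn n) : cubeProj r x ∈ closure (range (cubeProj r : Rn n → Rn n)) :=
    subset_closure (mem_range_self x)
  refine ⟨fun x => f (cubeProj r x), K, L.toNNReal, ?_, fun x => ?_, fun x hx => ?_⟩
  · have := hK.comp (lipschitzWith_cubeProj r).lipschitzOnWith fun x (_ : x ∈ univ) => hm x
    rwa [mul_one, lipschitzOnWith_univ] at this
  · exact (hL _ (hm x)).trans (Real.le_coe_toNNReal L)
  · simp only [cubeProj_of_norm_le hx]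

end Truncation

/-! ### Global flows, Grönwall estimates and uniqueness -/

section Solutions

variable {E : Type*} [NormedAddCommGroup E] [NormedSpace ℝ E]

lemma LipschitzWith.exists_isIntegralCurve [CompleteSpace E] {v : E → E} {K L : NNReal}
    (hv : LipschitzWith K v) (hL : ∀ x, ‖v x‖ ≤ L) (x₀ : E) :
    ∃ z : ℝ → E, z 0 = x₀ ∧ IsIntegralCurve z fun _ => v := by
  have hloc (N : ℕ) : ∃ z : ℝ → E, z 0 = x₀ ∧
      ∀ t ∈ Ioo (-(N + 1 : ℝ)) (N + 1), HasDerivAt z (v (z t)) t := by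
    have h0 : (0 : ℝ) ∈ Icc (-(N + 1 : ℝ)) (N + 1) :=
      ⟨by linarith [N.cast_nonneg (α := ℝ)], by positivity⟩
    -- At speed at most L a curve moves at most L(N + 1) in time N + 1, so this radius works for
    -- every N.
    have hPL : IsPicardLindelof (fun _ => v) (⟨0, h0⟩ : Icc (-(N + 1 : ℝ)) (N + 1)) x₀
        (L * (N + 1)) 0 L K :=
      .of_time_independent (fun x _ => hL x) hv.lipschitzOnWith (by simp)
    obtain ⟨z, hz0, hz⟩ := hPL.exists_eq_forall_mem_Icc_hasDerivWithinAt₀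
    exact ⟨z, hz0, fun t ht =>
      (hz t (Ioo_subset_Icc_self ht)).hasDerivAt (Icc_mem_nhds ht.1 ht.2)⟩
  choose z hz0 hz using hloc
  have hagree {M N : ℕ} (hMN : M ≤ N) : EqOn (z M) (z N) (Ioo (-(M + 1 : ℝ)) (M + 1)) := by
    have hMN' : (M : ℝ) ≤ N := Nat.cast_le.2 hMN
    have hM : (0 : ℝ) ≤ M := M.cast_nonneg
    exact ODE_solution_unique_of_mem_Ioo (v := fun _ => v) (s := fun _ => univ) (t₀ := 0)
      (fun _ _ => hv.lipschitzOnWith) ⟨by linarith, by linarith⟩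
      (fun t ht => ⟨hz M t ht, mem_univ _⟩)
      (fun t ht => ⟨hz N t ⟨by linarith [ht.1], by linarith [ht.2]⟩, mem_univ _⟩)
      ((hz0 M).trans (hz0 N).symm)
  have hmem (t : ℝ) : t ∈ Ioo (-((⌈|t|⌉₊ : ℕ) + 1 : ℝ)) ((⌈|t|⌉₊ : ℕ) + 1) := by
    refine abs_lt.1 ?_
    exact (Nat.le_ceil _).trans_lt (lt_add_one _)
  -- The extra 1 in the interval lengths makes t an interior point of the interval with index
  -- ⌈|t|⌉₊.
  refine ⟨fun t => z ⌈|t|⌉₊ t, hz0 _, fun t => ?_⟩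
  refine (hz _ t (hmem t)).congr_of_eventuallyEq ?_
  filter_upwards [Ioo_mem_nhds (hmem t).1 (hmem t).2] with s hs
  rcases le_total ⌈|s|⌉₊ ⌈|t|⌉₊ with h | h
  · exact hagree h (hmem s)
  · exact (hagree h hs).symm

lemma LipschitzWith.dist_le_of_isIntegralCurve_of_nonneg {v : E → E} {K : NNReal}
    (hv : LipschitzWith K v) {y z : ℝ → E} (hy : IsIntegralCurve y fun _ => v)
    (hz : IsIntegralCurve z fun _ => v) {t : ℝ} (ht : 0 ≤ t) :
    dist (y t) (z t) ≤ dist (y 0) (z 0) * Real.exp (K * t) := by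
  have := dist_le_of_trajectories_ODE (v := fun _ => v) (a := 0) (b := t) (fun _ => hv)
    hy.continuous.continuousOn (fun s _ => (hy s).hasDerivWithinAt)
    hz.continuous.continuousOn (fun s _ => (hz s).hasDerivWithinAt) le_rfl t ⟨ht, le_rfl⟩
  rwa [sub_zero] at this

lemma LipschitzWith.dist_le_of_isIntegralCurve {v : E → E} {K : NNReal}
    (hv : LipschitzWith K v) {y z : ℝ → E} (hy : IsIntegralCurve y fun _ => v)
    (hz : IsIntegralCurve z fun _ => v) (t : ℝ) :
    dist (y t) (z t) ≤ dist (y 0) (z 0) * Real.exp (K * |t|) := by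
  rcases le_total 0 t with ht | ht
  · rw [abs_of_nonneg ht]
    exact hv.dist_le_of_isIntegralCurve_of_nonneg hy hz ht
  · rw [abs_of_nonpos ht]
    have hrev {y : ℝ → E} (hy : IsIntegralCurve y fun _ => v) :
        IsIntegralCurve (fun s => y (-s)) fun _ x => -v x := fun s => by
      simpa [Function.comp_def] using (hy (-s)).scomp s (hasDerivAt_neg s)
    simpa using hv.neg.dist_le_of_isIntegralCurve_of_nonneg (hrev hy) (hrev hz) (neg_nonneg.2 ht)

lemma LocallyLipschitz.isIntegralCurve_unique {v : E → E} (hv : LocallyLipschitz v)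
    {y z : ℝ → E} (hy : IsIntegralCurve y fun _ => v) (hz : IsIntegralCurve z fun _ => v)
    (h0 : y 0 = z 0) : y = z := by
  ext t
  have hc : IsCompact (y '' Icc (-(|t| + 1)) (|t| + 1) ∪ z '' Icc (-(|t| + 1)) (|t| + 1)) :=
    (isCompact_Icc.image hy.continuous).union (isCompact_Icc.image hz.continuous)
  obtain ⟨K, hK⟩ := (hv.locallyLipschitzOn).exists_lipschitzOnWith_of_compact hc
  refine ODE_solution_unique_of_mem_Ioo (v := fun _ => v) (t₀ := 0) (fun _ _ => hK)
    ⟨by linarith [abs_nonneg t], by positivity⟩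
    (fun s hs => ⟨hy s, .inl (mem_image_of_mem _ (Ioo_subset_Icc_self hs))⟩)
    (fun s hs => ⟨hz s, .inr (mem_image_of_mem _ (Ioo_subset_Icc_self hs))⟩) h0 ?_
  exact abs_lt.1 (lt_add_one _)

lemma IsIntegralCurveOn.hasDerivWithinAt_Ici {v : E → E} {y : ℝ → E} {a T : ℝ}
    (hy : IsIntegralCurveOn y (fun _ => v) (Ico a T)) {t : ℝ} (ht : t ∈ Ico a T) :
    HasDerivWithinAt y (v (y t)) (Ici t) t :=
  (hy t ht).mono_of_mem_nhdsWithin (Ico_mem_nhdsGE_of_mem ht)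

lemma LocallyLipschitz.eqOn_of_isSolutionUpTo {n : ℕ} {v : Rn n → Rn n} (hv : LocallyLipschitz v)
    {p : Rn n} {T : ℝ} {y z : ℝ → Rn n} (hy : IsSolutionUpTo v p T y)
    (hz : IsSolutionUpTo v p T z) : EqOn y z (Ico 0 T) := by
  intro t ht
  have hsub : Icc 0 t ⊆ Ico 0 T := fun s hs => ⟨hs.1, hs.2.trans_lt ht.2⟩
  have hyc := hy.2.continuousOn.mono hsub
  have hzc := hz.2.continuousOn.mono hsub
  have hc : IsCompact (y '' Icc 0 t ∪ z '' Icc 0 t) :=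
    (isCompact_Icc.image_of_continuousOn hyc).union (isCompact_Icc.image_of_continuousOn hzc)
  obtain ⟨K, hK⟩ := (hv.locallyLipschitzOn).exists_lipschitzOnWith_of_compact hc
  exact ODE_solution_unique_of_mem_Icc_right (v := fun _ => v) (fun _ _ => hK)
    hyc (fun s hs => hy.2.hasDerivWithinAt_Ici (hsub (Ico_subset_Icc_self hs)))
    (fun s hs => .inl (mem_image_of_mem _ (Ico_subset_Icc_self hs)))
    hzc (fun s hs => hz.2.hasDerivWithinAt_Ici (hsub (Ico_subset_Icc_self hs)))
    (fun s hs => .inr (mem_image_of_mem _ (Ico_subset_Icc_self hs)))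
    (hy.1.trans hz.1.symm) ⟨ht.1, le_rfl⟩

lemma IsForwardSolution.isSolutionUpTo {n : ℕ} {v : Rn n → Rn n} {p : Rn n} {y : ℝ → Rn n}
    (hy : IsForwardSolution v p y) (T : ℝ) : IsSolutionUpTo v p T y :=
  ⟨hy.1, hy.2.mono fun _ ht => ht.1⟩

end Solutions

/-- A function that does not increase as long as it is above the level `c` stays below `c`. -/
lemma le_of_deriv_right_nonpos_of_lt {φ φ' : ℝ → ℝ} {a b c : ℝ} (hφ : ContinuousOn φ (Icc a b))
    (hd : ∀ t ∈ Ico a b, HasDerivWithinAt φ (φ' t) (Ici t) t) (ha : φ a ≤ c)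
    (hφ' : ∀ t ∈ Ico a b, c < φ t → φ' t ≤ 0) : ∀ t ∈ Icc a b, φ t ≤ c := by
  intro t ht
  -- The summand 1 keeps the barrier strictly above c even at t = a, so at any contact φ > c and its
  -- slope is below ε.
  have key (ε : ℝ) (hε : 0 < ε) : φ t ≤ c + ε * (1 + t - a) := by
    refine image_le_of_deriv_right_lt_deriv_boundary (B := fun t => c + ε * (1 + t - a))
      (B' := fun _ => ε) hφ hd (by simp; linarith) (fun s => ?_) (fun s hs hse => ?_) ht
    · simpa using ((((hasDerivAt_id s).const_add 1).sub_const a).const_mul ε).const_add c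
    · refine (hφ' s hs ?_).trans_lt hε
      rw [hse]
      nlinarith [hs.1]
  have hlim : Tendsto (fun ε : ℝ => c + ε * (1 + t - a)) (𝓝[>] 0) (𝓝 (c + 0 * (1 + t - a))) :=
    (Continuous.tendsto (by fun_prop) 0).mono_left nhdsWithin_le_nhds
  rw [zero_mul, add_zero] at hlim
  exact ge_of_tendsto hlim (eventually_mem_nhdsWithin.mono key)

/-! ### Positive limit sets -/

section LimitSet

variable {n : ℕ} {x : ℝ → Rn n}

lemma mem_positiveLimitSet_iff {p : Rn n} :
    p ∈ positiveLimitSet x ↔ ∀ T : ℝ, p ∈ closure (x '' Ici T) := by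
  constructor
  · rintro ⟨t, ht, htp⟩ T
    refine mem_closure_of_tendsto htp ?_
    filter_upwards [ht.eventually_ge_atTop T] with i hi using mem_image_of_mem _ hi
  · intro h
    have hex (i : ℕ) : ∃ t : ℝ, (i : ℝ) ≤ t ∧ dist p (x t) < 1 / ((i : ℝ) + 1) := by
      obtain ⟨_, ⟨t, ht, rfl⟩, hd⟩ :=
        Metric.mem_closure_iff.1 (h i) (1 / ((i : ℝ) + 1)) (by positivity)
      exact ⟨t, ht, hd⟩
    choose t ht htd using hex
    refine ⟨t, tendsto_atTop_mono ht tendsto_natCast_atTop_atTop, ?_⟩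
    rw [tendsto_iff_dist_tendsto_zero]
    refine squeeze_zero (fun _ => dist_nonneg) (fun i => ?_) tendsto_one_div_add_atTop_nhds_zero_nat
    rw [dist_comm]
    exact (htd i).le

lemma isClosed_positiveLimitSet : IsClosed (positiveLimitSet x) := by
  have : positiveLimitSet x = ⋂ T : ℝ, closure (x '' Ici T) := by
    ext p
    rw [mem_positiveLimitSet_iff, mem_iInter]
  rw [this]
  exact isClosed_iInter fun _ => isClosed_closure

variable {C : Set (Rn n)}

lemma positiveLimitSet_subset (hC : IsClosed C) (hx : ∀ᶠ t in atTop, x t ∈ C) :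
    positiveLimitSet x ⊆ C := by
  rintro p ⟨t, ht, htp⟩
  exact hC.mem_of_tendsto htp (ht.eventually hx)

/-- Otherwise the curve visits C \ U at arbitrarily late times, and compactness produces a limit
point outside U. -/
lemma eventually_mem_of_positiveLimitSet_subset (hC : IsCompact C) (hx : ∀ᶠ t in atTop, x t ∈ C)
    {U : Set (Rn n)} (hU : IsOpen U) (hLU : positiveLimitSet x ⊆ U) : ∀ᶠ t in atTop, x t ∈ U := by
  by_contra h
  obtain ⟨t, ht, htU⟩ := exists_seq_forall_of_frequently ((not_eventually.1 h).and_eventually hx)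
  obtain ⟨p, -, φ, hφ, hp⟩ := hC.tendsto_subseq fun i => (htU i).2
  have hpL : p ∈ positiveLimitSet x := ⟨t ∘ φ, ht.comp hφ.tendsto_atTop, hp⟩
  exact hU.isClosed_compl.mem_of_tendsto hp (.of_forall fun i => (htU (φ i)).1) (hLU hpL)

lemma positiveLimitSet_nonempty (hC : IsCompact C) (hx : ∀ᶠ t in atTop, x t ∈ C) :
    (positiveLimitSet x).Nonempty := by
  by_contra h
  rw [not_nonempty_iff_eq_empty] at h
  obtain ⟨t, ht⟩ := (eventually_mem_of_positiveLimitSet_subset hC hx isOpen_empty h.le).exists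
  exact ht

lemma isCompact_positiveLimitSet (hC : IsCompact C) (hx : ∀ᶠ t in atTop, x t ∈ C) :
    IsCompact (positiveLimitSet x) :=
  hC.of_isClosed_subset isClosed_positiveLimitSet (positiveLimitSet_subset hC.isClosed hx)

/-- If disjoint closed sets split the limit set, a connected tail of the curve lies in one of two
separating open sets, and its closure misses the other piece. -/
lemma isConnected_positiveLimitSet (hC : IsCompact C) (hx : ∀ᶠ t in atTop, x t ∈ C)
    (hcont : ContinuousOn x (Ici 0)) : IsConnected (positiveLimitSet x) := by
  refine ⟨positiveLimitSet_nonempty hC hx, ?_⟩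
  rw [isPreconnected_iff_subset_of_fully_disjoint_closed isClosed_positiveLimitSet]
  intro u v hu hv huv hd
  obtain ⟨U, V, hU, hV, huU, hvV, hUV⟩ := normal_separation hu hv hd
  obtain ⟨T, hT⟩ := eventually_atTop.1 (eventually_mem_of_positiveLimitSet_subset hC hx
    (hU.union hV) (huv.trans (union_subset_union huU hvV)))
  have hpre : IsPreconnected (x '' Ici (max T 0)) :=
    isPreconnected_Ici.image _ (hcont.mono (Ici_subset_Ici.2 (le_max_right _ _)))
  have hsub : x '' Ici (max T 0) ⊆ U ∪ V := by
    rintro _ ⟨t, ht, rfl⟩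
    exact hT t ((le_max_left _ _).trans ht)
  have hside {U V u v : Set (Rn n)} (hV : IsOpen V) (hUV : Disjoint U V) (hvV : v ⊆ V)
      (huv : positiveLimitSet x ⊆ u ∪ v) (h : x '' Ici (max T 0) ⊆ U) :
      positiveLimitSet x ⊆ u := fun p hp => by
    refine (huv hp).resolve_right fun hpv => ?_
    have := closure_mono h (mem_positiveLimitSet_iff.1 hp _)
    exact disjoint_left.1 (hUV.closure_left hV) this (hvV hpv)
  rcases isPreconnected_iff_subset_of_disjoint.1 hpre U V hU hV hsub
    (by rw [hUV.inter_eq, inter_empty]) with h | h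
  · exact .inl (hside hV hUV hvV huv h)
  · exact .inr (hside hU hUV.symm huU (by rwa [union_comm]) h)

lemma tendsto_of_positiveLimitSet_subset_singleton (hC : IsCompact C)
    (hx : ∀ᶠ t in atTop, x t ∈ C) {p : Rn n} (hp : positiveLimitSet x ⊆ {p}) :
    Tendsto x atTop (𝓝 p) := by
  refine tendsto_def.2 fun s hs => ?_
  obtain ⟨U, hUs, hU, hpU⟩ := mem_nhds_iff.1 hs
  filter_upwards [eventually_mem_of_positiveLimitSet_subset hC hx hU
    (hp.trans (singleton_subset_iff.2 hpU))] with t ht using hUs ht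

/-- For a Lipschitz vector field, positive limit sets are invariant under the flow. -/
lemma LipschitzWith.mem_positiveLimitSet {v : Rn n → Rn n} {K : NNReal} (hv : LipschitzWith K v)
    (hx : IsIntegralCurve x fun _ => v) {z : ℝ → Rn n} (hz : IsIntegralCurve z fun _ => v)
    (h0 : z 0 ∈ positiveLimitSet x) (t : ℝ) : z t ∈ positiveLimitSet x := by
  obtain ⟨s, hs, hsp⟩ := h0
  refine ⟨fun i => s i + t, tendsto_atTop_add_const_right _ _ hs, ?_⟩
  rw [tendsto_iff_dist_tendsto_zero] at hsp ⊢
  have hlim := hsp.mul_const (Real.exp (K * |t|))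
  rw [zero_mul] at hlim
  refine squeeze_zero (fun _ => dist_nonneg) (fun i => ?_) hlim
  have := hv.dist_le_of_isIntegralCurve (hx.comp_add (s i)) hz t
  simpa [add_comm] using this

end LimitSet

lemma HasGradientAt.comp_hasDerivWithinAt {E : Type*} [NormedAddCommGroup E]
    [InnerProductSpace ℝ E] [CompleteSpace E] {φ : E → ℝ} {y : ℝ → E} {y' : E} {G : E} {s : Set ℝ}
    {t : ℝ} (hφ : HasGradientAt φ G (y t)) (hy : HasDerivWithinAt y y' s t) :
    HasDerivWithinAt (fun τ => φ (y τ)) (inner ℝ G y') s t := by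
  simpa [Function.comp_def] using hφ.hasFDerivAt.comp_hasDerivWithinAt t hy

/-- Along a linearly independent family that depends continuously on a parameter, linear
combinations are bounded below uniformly near the given parameter. -/
lemma LinearIndependent.eventually_le_norm_sum {X E ι : Type*} [TopologicalSpace X]
    [NormedAddCommGroup E] [NormedSpace ℝ E] [Fintype ι] {e : X → ι → E} {x₀ : X}
    (h0 : LinearIndependent ℝ (e x₀)) (he : ∀ i, ContinuousAt (fun x => e x i) x₀) :
    ∃ c > 0, ∀ᶠ x in 𝓝 x₀, ∀ v : ι → ℝ, c * ‖v‖ ≤ ‖∑ i, v i • e x i‖ := by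
  obtain ⟨K, hK, hanti⟩ := LinearMap.exists_antilipschitzWith (Fintype.linearCombination ℝ (e x₀))
    (LinearMap.ker_eq_bot.2 (h0.fintypeLinearCombination_injective))
  have hK' : (0 : ℝ) < K := hK
  have hlow (v : ι → ℝ) : ‖v‖ ≤ K * ‖∑ i, v i • e x₀ i‖ := by
    simpa [Fintype.linearCombination_apply] using hanti.le_mul_dist v 0
  have hsmall : ∀ᶠ x in 𝓝 x₀, ∑ i, ‖e x i - e x₀ i‖ < (2 * K : ℝ)⁻¹ := by
    have hc : ContinuousAt (fun x => ∑ i, ‖e x i - e x₀ i‖) x₀ :=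
      tendsto_finsetSum _ fun i _ => ((he i).sub continuousAt_const).norm
    refine hc.eventually_lt continuousAt_const ?_
    simp only [sub_self, norm_zero, Finset.sum_const_zero]
    positivity
  -- Perturbing the family by less than 1/(2K) costs half of ‖v‖ in ‖v‖ ≤ K‖∑ vᵢeᵢ‖.
  refine ⟨(2 * K : ℝ)⁻¹, by positivity, hsmall.mono fun x hx v => ?_⟩
  have hdiff : ‖∑ i, v i • e x₀ i‖ ≤ ‖∑ i, v i • e x i‖ + (2 * K : ℝ)⁻¹ * ‖v‖ := by
    have h1 : ∑ i, v i • e x₀ i = ∑ i, v i • e x i - ∑ i, v i • (e x i - e x₀ i) := by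
      simp [smul_sub]
    rw [h1]
    refine (norm_sub_le _ _).trans (add_le_add_right ?_ _)
    refine (norm_sum_le _ _).trans ?_
    refine le_trans ?_ (mul_le_mul_of_nonneg_right hx.le (norm_nonneg v))
    rw [Finset.sum_mul]
    refine Finset.sum_le_sum fun i _ => ?_
    rw [norm_smul, mul_comm]
    exact mul_le_mul_of_nonneg_left (norm_le_pi_norm v i) (norm_nonneg _)
  have h2 := (hlow v).trans (mul_le_mul_of_nonneg_left hdiff hK'.le)
  have h3 : (K : ℝ) * ((2 * K : ℝ)⁻¹ * ‖v‖) = ‖v‖ / 2 := by field_simp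
  rw [mul_add, h3] at h2
  rw [inv_mul_le_iff₀ (by positivity)]
  linarith

/-! ### V and θ along solutions, equilibria, and trapping -/

namespace NLP

variable {n m k : ℕ}

/-- The standing assumptions on the problem and on the parameter functions of the system. -/
structure Standing (P : NLP n m k) (σ ψ₁ ψ₂ : Rn n → ℝ) : Prop where
  smooth_θ : ContDiff ℝ 2 P.θ
  smooth_h : ∀ i, ContDiff ℝ 2 (P.h i)
  smooth_g : ∀ j, ContDiff ℝ 2 (P.g j)
  sublevelCompact : P.SublevelCompact
  licq : P.LICQ
  noInfeasibleCritical : P.NoInfeasibleCritical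
  lipschitz_ψ₁ : LocallyLipschitz ψ₁
  ψ₁_pos : ∀ x, 0 < ψ₁ x
  lipschitz_ψ₂ : LocallyLipschitz ψ₂
  ψ₂_pos : ∀ x, 0 < ψ₂ x
  sublevelInclusion : P.SublevelInclusion ψ₁ ψ₂
  lipschitz_σ : LocallyLipschitz σ
  σ_pos : ∀ x, 0 < σ x

variable {P : NLP n m k} {σ ψ₁ ψ₂ : Rn n → ℝ}

lemma V_nonneg (P : NLP n m k) (x : Rn n) : 0 ≤ P.V x := by
  unfold V
  positivity

lemma sq_h_le (P : NLP n m k) (x : Rn n) (i : Fin m) : P.h i x ^ 2 ≤ 2 * P.V x := by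
  have h1 : P.h i x ^ 2 ≤ ∑ i, P.h i x ^ 2 :=
    Finset.single_le_sum (f := fun i => P.h i x ^ 2) (fun _ _ => sq_nonneg _) (Finset.mem_univ i)
  have h2 : 0 ≤ ∑ j, P.gPos x j ^ 2 := by positivity
  unfold V
  linarith

lemma sq_gPos_le (P : NLP n m k) (x : Rn n) (j : Fin k) : P.gPos x j ^ 2 ≤ 2 * P.V x := by
  have h1 : P.gPos x j ^ 2 ≤ ∑ j, P.gPos x j ^ 2 :=
    Finset.single_le_sum (f := fun j => P.gPos x j ^ 2) (fun _ _ => sq_nonneg _)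
      (Finset.mem_univ j)
  have h2 : 0 ≤ ∑ i, P.h i x ^ 2 := by positivity
  unfold V
  linarith

lemma mem_S_iff_V_eq_zero {x : Rn n} : x ∈ P.S ↔ P.V x = 0 := by
  constructor
  · rintro ⟨hh, hg⟩
    simp [V, hh, gPos, hg]
  · intro h
    refine ⟨fun i => ?_, fun j => ?_⟩
    · have := P.sq_h_le x i
      rw [h, mul_zero] at this
      exact pow_eq_zero_iff two_ne_zero |>.1 (le_antisymm this (sq_nonneg _))
    · have := P.sq_gPos_le x j
      rw [h, mul_zero] at this
      have := pow_eq_zero_iff two_ne_zero |>.1 (le_antisymm this (sq_nonneg _))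
      simpa [gPos] using this

namespace Standing

variable (D : P.Standing σ ψ₁ ψ₂)
include D

lemma lipschitz_f : LocallyLipschitz (P.f σ ψ₁ ψ₂) :=
  locallyLipschitz_f D.smooth_θ D.smooth_h D.smooth_g D.lipschitz_ψ₁ D.lipschitz_ψ₂ D.lipschitz_σ

lemma hasGradientAt_V (x : Rn n) : HasGradientAt P.V (gradient P.V x) x := by
  rw [gradient_V D.smooth_h D.smooth_g]
  exact NLP.hasGradientAt_V D.smooth_h D.smooth_g x

lemma hasGradientAt_θ (x : Rn n) : HasGradientAt P.θ (gradient P.θ x) x :=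
  (D.smooth_θ.differentiable (by norm_num) x).hasGradientAt

lemma continuous_V : Continuous P.V :=
  continuous_iff_continuousAt.2 fun x => (D.hasGradientAt_V x).continuousAt

lemma continuous_θ : Continuous P.θ := D.smooth_θ.continuous

lemma inner_gradient_V_F_nonpos (x : Rn n) : inner ℝ (gradient P.V x) (P.F x) ≤ 0 := by
  rw [EuclideanSpace.inner_eq_star_dotProduct, star_trivial, dotProduct_comm,
    ofLp_gradient_V D.smooth_h D.smooth_g, add_dotProduct, mulVec_transpose, mulVec_transpose,
    ← dotProduct_mulVec, ← dotProduct_mulVec, A_mulVec_F, dotProduct_zero, zero_add,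
    gPos_dotProduct_B_mulVec_F, neg_nonpos]
  have h1 := P.dA_nonneg x
  have h2 := P.det_Q_nonneg x
  have h3 : 0 ≤ ∑ j, P.gPos x j * max 0 (P.w x j) :=
    Finset.sum_nonneg fun j _ => mul_nonneg (P.gPos_nonneg x j) (le_max_left _ _)
  positivity

omit D in
lemma inner_gradient_θ_F (x : Rn n) :
    inner ℝ (gradient P.θ x) (P.F x) = P.gradθ x ⬝ᵥ (P.F x).ofLp := by
  rw [EuclideanSpace.inner_eq_star_dotProduct, star_trivial, dotProduct_comm]
  rfl

lemma inner_gradient_V_f_le (x : Rn n) : inner ℝ (gradient P.V x) (P.f σ ψ₁ ψ₂ x)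
    ≤ -(σ x * ψ₂ x * ‖gradient P.V x‖ ^ 2) := by
  have h := mul_nonneg (mul_pos (D.σ_pos x) (D.ψ₁_pos x)).le
    (neg_nonneg.2 (D.inner_gradient_V_F_nonpos x))
  simp only [f, inner_sub_right, inner_add_right, inner_smul_right, real_inner_self_eq_norm_sq]
  nlinarith

lemma inner_gradient_V_f_nonpos (x : Rn n) :
    inner ℝ (gradient P.V x) (P.f σ ψ₁ ψ₂ x) ≤ 0 := by
  have := D.σ_pos x
  have := D.ψ₂_pos x
  exact (D.inner_gradient_V_f_le x).trans (neg_nonpos.2 (by positivity))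

omit D in
lemma inner_gradient_θ_f (x : Rn n) :
    inner ℝ (gradient P.θ x) (P.f σ ψ₁ ψ₂ x) = σ x * P.a ψ₁ ψ₂ x := by
  simp only [f, a, inner_sub_right, inner_add_right, inner_smul_right, real_inner_self_eq_norm_sq,
    real_inner_comm (gradient P.V x) (gradient P.θ x), sq_abs]
  ring

/-- By Cauchy–Schwarz −|∇V|²|∇θ|² + ⟨∇V, ∇θ⟩² ≤ 0, and ∇θ F ≤ 0; only the ψ₂ term can raise θ. -/
lemma inner_gradient_θ_f_le (x : Rn n) : inner ℝ (gradient P.θ x) (P.f σ ψ₁ ψ₂ x)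
    ≤ σ x * ψ₂ x * (‖gradient P.V x‖ * ‖gradient P.θ x‖) := by
  rw [inner_gradient_θ_f, mul_assoc]
  refine mul_le_mul_of_nonneg_left ?_ (D.σ_pos x).le
  have h1 : ψ₁ x * inner ℝ (gradient P.θ x) (P.F x) ≤ 0 := by
    rw [inner_gradient_θ_F]
    exact mul_nonpos_of_nonneg_of_nonpos (D.ψ₁_pos x).le (P.gradθ_dotProduct_F_nonpos x)
  have h2 := abs_real_inner_le_norm (gradient P.V x) (gradient P.θ x)
  have h3 := pow_le_pow_left₀ (abs_nonneg _) h2 2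
  have h4 := mul_le_mul_of_nonneg_left ((neg_le_abs _).trans h2) (D.ψ₂_pos x).le
  rw [mul_pow] at h3
  unfold a
  linarith

lemma mem_S_iff_gradient_V_eq_zero {x : Rn n} : x ∈ P.S ↔ gradient P.V x = 0 := by
  constructor
  · rintro ⟨hh, hg⟩
    rw [gradient_V D.smooth_h D.smooth_g]
    simp [hh, gPos, hg]
  · intro h
    have h1 := ofLp_gradient_V D.smooth_h D.smooth_g x
    rw [h] at h1
    obtain ⟨e1, e2⟩ := D.noInfeasibleCritical x h1.symm
    exact ⟨fun i => congrFun e1 i, fun j => max_eq_left_iff.1 (congrFun e2 j)⟩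

lemma f_eq_of_mem_S {x : Rn n} (hx : x ∈ P.S) :
    P.f σ ψ₁ ψ₂ x = (σ x * ψ₁ x) • P.F x := by
  simp [f, D.mem_S_iff_gradient_V_eq_zero.1 hx]

lemma mem_S_of_inner_eq_zero {x : Rn n}
    (h : inner ℝ (gradient P.V x) (P.f σ ψ₁ ψ₂ x) = 0) : x ∈ P.S := by
  rw [D.mem_S_iff_gradient_V_eq_zero, ← norm_eq_zero, ← pow_eq_zero_iff two_ne_zero]
  have h1 := D.inner_gradient_V_f_le x
  have h2 := mul_pos (D.σ_pos x) (D.ψ₂_pos x)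
  rw [h] at h1
  nlinarith [sq_nonneg ‖gradient P.V x‖]

lemma mem_Φ_of_inner_eq_zero {x : Rn n} (hx : x ∈ P.S)
    (h : inner ℝ (gradient P.θ x) (P.f σ ψ₁ ψ₂ x) = 0) : x ∈ P.Φ := by
  rw [D.f_eq_of_mem_S hx, inner_smul_right, inner_gradient_θ_F] at h
  exact D.licq.mem_Φ_of_dotProduct_eq_zero hx
    ((mul_eq_zero.1 h).resolve_left (mul_pos (D.σ_pos x) (D.ψ₁_pos x)).ne')

lemma f_eq_zero_iff (p : Rn n) : P.f σ ψ₁ ψ₂ p = 0 ↔ p ∈ P.Φ := by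
  constructor
  · intro h
    exact D.mem_Φ_of_inner_eq_zero (D.mem_S_of_inner_eq_zero (by rw [h, inner_zero_right]))
      (by rw [h, inner_zero_right])
  · intro h
    rw [D.f_eq_of_mem_S h.1, D.licq.F_eq_zero_of_mem_Φ h, smul_zero]

lemma V_le_of_isSolutionUpTo {p : Rn n} {T : ℝ} {y : ℝ → Rn n}
    (hy : IsSolutionUpTo (P.f σ ψ₁ ψ₂) p T y) {s t : ℝ} (hs : 0 ≤ s) (hst : s ≤ t) (ht : t < T) :
    P.V (y t) ≤ P.V (y s) := by
  have hsub : Icc s t ⊆ Ico 0 T := fun τ hτ => ⟨hs.trans hτ.1, hτ.2.trans_lt ht⟩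
  exact le_of_deriv_right_nonpos_of_lt
    (D.continuous_V.comp_continuousOn (hy.2.continuousOn.mono hsub))
    (fun τ hτ => (D.hasGradientAt_V _).comp_hasDerivWithinAt
      (hy.2.hasDerivWithinAt_Ici (hsub (Ico_subset_Icc_self hτ)))) le_rfl
    (fun τ _ _ => D.inner_gradient_V_f_nonpos _) t ⟨hst, le_rfl⟩

lemma isPositivelyInvariantSet_S : IsPositivelyInvariantSet (P.f σ ψ₁ ψ₂) P.S := by
  intro p hp T y hy t ht
  rw [mem_S_iff_V_eq_zero] at hp ⊢
  have := D.V_le_of_isSolutionUpTo hy le_rfl ht.1 ht.2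
  rw [hy.1, hp] at this
  exact le_antisymm this (P.V_nonneg _)

/-- Every solution is trapped in a compact set, and coincides with a solution of a system with a
bounded Lipschitz right-hand side. -/
lemma exists_trapped (x₀ : Rn n) : ∃ (C : Set (Rn n)) (v : Rn n → Rn n) (K L : NNReal)
    (x : ℝ → Rn n), IsCompact C ∧ LipschitzWith K v ∧ (∀ q, ‖v q‖ ≤ L) ∧
      (∀ q ∈ C, v q = P.f σ ψ₁ ψ₂ q) ∧ x 0 = x₀ ∧ (IsIntegralCurve x fun _ => v) ∧
      ∀ t, 0 ≤ t → x t ∈ C := by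
  obtain ⟨y, hyV, hyθ, hya⟩ := D.sublevelInclusion x₀
  set C := {q | P.V q ≤ P.V x₀ ∧ P.θ q ≤ P.θ y} with hCdef
  have hC : IsCompact C := D.sublevelCompact x₀ y hyV
  obtain ⟨r, hr⟩ := isBounded_iff_forall_norm_le.1 hC.isBounded
  -- The margin 1 makes v = f on a neighbourhood of C, so the estimates for f apply for a short time
  -- after any instant spent in C.
  obtain ⟨v, K, L, hv, hL, hvf⟩ := D.lipschitz_f.exists_truncation (r + 1)
  obtain ⟨x, hx0, hx⟩ := hv.exists_isIntegralCurve hL x₀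
  refine ⟨C, v, K, L, x, hC, hv, hL, fun q hq => hvf q ((hr q hq).trans (by linarith)), hx0, hx,
    fun t ht => ?_⟩
  have hsub : Icc 0 t ⊆ x ⁻¹' C := by
    refine IsClosed.Icc_subset_of_forall_exists_gt
      ((hC.isClosed.preimage hx.continuous).inter isClosed_Icc) ?_ ?_
    · exact ⟨by rw [hx0], by rw [hx0]; exact hyθ⟩
    rintro s ⟨hs, -⟩ s' hs'
    have hnear : ∀ᶠ τ in 𝓝 s, ‖x τ‖ < r + 1 :=
      hx.continuous.norm.continuousAt.eventually_lt continuousAt_const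
        ((hr _ hs).trans_lt (lt_add_one r))
    obtain ⟨δ, hδ, hball⟩ := Metric.eventually_nhds_iff.1 hnear
    set b := min s' (s + δ / 2) with hb
    have hsb : s < b := lt_min hs' (by linarith)
    have hode : ∀ τ ∈ Ico s b, HasDerivWithinAt x (P.f σ ψ₁ ψ₂ (x τ)) (Ici τ) τ := fun τ hτ => by
      rw [← hvf]
      · exact (hx τ).hasDerivWithinAt
      · refine (hball ?_).le
        have h2 : τ < s + δ / 2 := hτ.2.trans_le (min_le_right _ _)
        rw [Real.dist_eq, abs_lt]
        constructor <;> linarith [hτ.1]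
    have hV := le_of_deriv_right_nonpos_of_lt (c := P.V x₀)
      (D.continuous_V.comp hx.continuous).continuousOn
      (fun τ hτ => (D.hasGradientAt_V _).comp_hasDerivWithinAt (hode τ hτ)) hs.1
      (fun τ _ _ => D.inner_gradient_V_f_nonpos _)
    -- Given V ≤ V(x₀), θ can rise only where a > 0, and (A4) places those points at or below the
    -- level θ(y).
    have hθ := le_of_deriv_right_nonpos_of_lt (c := P.θ y)
      (D.continuous_θ.comp hx.continuous).continuousOn
      (fun τ hτ => (D.hasGradientAt_θ _).comp_hasDerivWithinAt (hode τ hτ)) hs.2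
      (fun τ hτ hlt => by
        rw [inner_gradient_θ_f]
        refine mul_nonpos_of_nonneg_of_nonpos (D.σ_pos _).le (not_lt.1 fun ha => ?_)
        exact (hya ⟨ha, hV τ (Ico_subset_Icc_self hτ)⟩).not_gt hlt)
    exact ⟨b, ⟨hV b ⟨hsb.le, le_rfl⟩, hθ b ⟨hsb.le, le_rfl⟩⟩, hsb, min_le_left _ _⟩
  exact hsub ⟨ht, le_rfl⟩

/-! ### Exponential decay of V and bounded growth of θ near S -/

omit D in
/-- On a tame set, `V` decays exponentially along solutions and the growth of `θ` is controlled by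
`√V`. -/
def Tame (P : NLP n m k) (σ ψ₂ : Rn n → ℝ) (U : Set (Rn n)) : Prop :=
  ∃ β > 0, ∃ K ≥ 0, ∀ q ∈ U, β * P.V q ≤ σ q * ψ₂ q * ‖gradient P.V q‖ ^ 2 ∧
    σ q * ψ₂ q * (‖gradient P.V q‖ * ‖gradient P.θ q‖) ≤ K * √(P.V q)

/-- Near p the constraints inactive at p drop out of ∇V, which is then a combination of the LICQ
family with coefficients h and g⁺. -/
lemma exists_mul_V_le {p : Rn n} (hp : p ∈ P.S) :
    ∃ c > 0, ∀ᶠ q in 𝓝 p, c * P.V q ≤ ‖gradient P.V q‖ ^ 2 := by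
  classical
  obtain ⟨c, hc, hev⟩ := (D.licq p hp).eventually_le_norm_sum
    (e := fun q => Sum.elim (fun i : Fin m => gradient (P.h i) q)
      (fun j : {j : Fin k // P.g j p = 0} => gradient (P.g j) q)) (x₀ := p) (by
    rintro (i | j)
    · exact (D.smooth_h i).locallyLipschitz_gradient.continuous.continuousAt
    · exact (D.smooth_g j).locallyLipschitz_gradient.continuous.continuousAt)
  have hinact : ∀ᶠ q in 𝓝 p, ∀ j, P.g j p ≠ 0 → P.gPos q j = 0 := by
    refine eventually_all.2 fun j => ?_
    by_cases hj : P.g j p = 0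
    · exact .of_forall fun q h => absurd hj h
    · filter_upwards [(D.smooth_g j).continuous.continuousAt.eventually_lt continuousAt_const
        (lt_of_le_of_ne (hp.2 j) hj)] with q hq _
      exact max_eq_left hq.le
  -- The factor m + k compares a sum of squares with the sup norm; the 1 avoids division by zero for
  -- m = k = 0.
  refine ⟨2 * c ^ 2 / (m + k + 1), by positivity, ?_⟩
  filter_upwards [hev, hinact] with q hq hin
  set v : Fin m ⊕ {j : Fin k // P.g j p = 0} → ℝ :=
    Sum.elim (fun i => P.h i q) (fun j => P.gPos q j) with hv
  have hsum : ∑ i, v i • Sum.elim (fun i : Fin m => gradient (P.h i) q)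
      (fun j : {j : Fin k // P.g j p = 0} => gradient (P.g j) q) i = gradient P.V q := by
    rw [gradient_V D.smooth_h D.smooth_g, Fintype.sum_sum_type]
    simp only [hv, Sum.elim_inl, Sum.elim_inr]
    congr 1
    rw [← Fintype.sum_subtype_add_sum_subtype (fun j => P.g j p = 0), left_eq_add]
    exact Finset.sum_eq_zero fun j _ => by rw [hin j j.2, zero_smul]
  have hbound := hq v
  rw [hsum] at hbound
  have hsq := pow_le_pow_left₀ (by positivity) hbound 2
  have hVle : 2 * P.V q ≤ (m + k) * ‖v‖ ^ 2 := by
    have e1 : ∑ i, P.h i q ^ 2 ≤ m * ‖v‖ ^ 2 := by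
      refine (Finset.sum_le_card_nsmul _ _ (‖v‖ ^ 2) fun i _ => ?_).trans (by simp)
      rw [← sq_abs]
      exact pow_le_pow_left₀ (abs_nonneg _) (norm_le_pi_norm v (Sum.inl i)) 2
    have e2 : ∑ j, P.gPos q j ^ 2 ≤ k * ‖v‖ ^ 2 := by
      refine (Finset.sum_le_card_nsmul _ _ (‖v‖ ^ 2) fun j _ => ?_).trans (by simp)
      by_cases hj : P.g j p = 0
      · rw [← sq_abs]
        exact pow_le_pow_left₀ (abs_nonneg _) (norm_le_pi_norm v (Sum.inr ⟨j, hj⟩)) 2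
      · rw [hin j hj]
        simp
    unfold V
    linarith
  calc 2 * c ^ 2 / (m + k + 1) * P.V q = c ^ 2 * (2 * P.V q) / (m + k + 1) := by ring
    _ ≤ c ^ 2 * ((m + k) * ‖v‖ ^ 2) / (m + k + 1) := by gcongr
    _ ≤ c ^ 2 * ((m + k + 1) * ‖v‖ ^ 2) / (m + k + 1) := by
      gcongr c ^ 2 * (?_ * ‖v‖ ^ 2) / (m + k + 1)
      linarith
    _ = (c * ‖v‖) ^ 2 := by field_simp
    _ ≤ _ := hsq

lemma norm_gradient_V_le (q : Rn n) : ‖gradient P.V q‖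
    ≤ √(2 * P.V q) * (∑ i, ‖gradient (P.h i) q‖ + ∑ j, ‖gradient (P.g j) q‖) := by
  rw [gradient_V D.smooth_h D.smooth_g, mul_add, Finset.mul_sum, Finset.mul_sum]
  refine (norm_add_le _ _).trans (add_le_add ((norm_sum_le _ _).trans ?_)
    ((norm_sum_le _ _).trans ?_))
  · refine Finset.sum_le_sum fun i _ => ?_
    rw [norm_smul]
    exact mul_le_mul_of_nonneg_right (Real.abs_le_sqrt (P.sq_h_le q i)) (norm_nonneg _)
  · refine Finset.sum_le_sum fun j _ => ?_
    rw [norm_smul]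
    exact mul_le_mul_of_nonneg_right (Real.abs_le_sqrt (P.sq_gPos_le q j)) (norm_nonneg _)

lemma exists_tame_nhds {p : Rn n} (hp : p ∈ P.S) : ∃ U ∈ 𝓝 p, Tame P σ ψ₂ U := by
  obtain ⟨c, hc, hev⟩ := D.exists_mul_V_le hp
  have hσψ : Continuous fun q => σ q * ψ₂ q :=
    D.lipschitz_σ.continuous.mul D.lipschitz_ψ₂.continuous
  set B : Rn n → ℝ := fun q => √2 * (∑ i, ‖gradient (P.h i) q‖ + ∑ j, ‖gradient (P.g j) q‖)
    * (σ q * ψ₂ q * ‖gradient P.θ q‖) with hB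
  have hBc : Continuous B := by
    have c1 (i : Fin m) := (D.smooth_h i).locallyLipschitz_gradient.continuous
    have c2 (j : Fin k) := (D.smooth_g j).locallyLipschitz_gradient.continuous
    have c3 := D.smooth_θ.locallyLipschitz_gradient.continuous
    fun_prop
  have hpos := mul_pos (D.σ_pos p) (D.ψ₂_pos p)
  have h1 : ∀ᶠ q in 𝓝 p, σ p * ψ₂ p / 2 < σ q * ψ₂ q :=
    continuousAt_const.eventually_lt hσψ.continuousAt (by linarith)
  have h2 : ∀ᶠ q in 𝓝 p, B q < |B p| + 1 :=
    hBc.continuousAt.eventually_lt continuousAt_const ((le_abs_self _).trans_lt (lt_add_one _))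
  refine ⟨_, hev.and (h1.and h2), σ p * ψ₂ p / 2 * c, by positivity, |B p| + 1, by positivity,
    fun q hq => ⟨?_, ?_⟩⟩
  · rw [mul_assoc]
    exact mul_le_mul hq.2.1.le hq.1 (mul_nonneg hc.le (P.V_nonneg q)) (by linarith [hq.2.1])
  · have hs := (mul_pos (D.σ_pos q) (D.ψ₂_pos q)).le
    calc σ q * ψ₂ q * (‖gradient P.V q‖ * ‖gradient P.θ q‖)
        = ‖gradient P.V q‖ * (σ q * ψ₂ q * ‖gradient P.θ q‖) := by ring
      _ ≤ √(2 * P.V q) * (∑ i, ‖gradient (P.h i) q‖ + ∑ j, ‖gradient (P.g j) q‖)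
          * (σ q * ψ₂ q * ‖gradient P.θ q‖) :=
        mul_le_mul_of_nonneg_right (D.norm_gradient_V_le q) (mul_nonneg hs (norm_nonneg _))
      _ = B q * √(P.V q) := by rw [Real.sqrt_mul zero_le_two, hB]; ring
      _ ≤ _ := mul_le_mul_of_nonneg_right hq.2.2.le (Real.sqrt_nonneg _)

omit D in
lemma Tame.mono {U U' : Set (Rn n)} (hU : Tame P σ ψ₂ U') (h : U ⊆ U') : Tame P σ ψ₂ U := by
  obtain ⟨β, hβ, K, hK, hq⟩ := hU
  exact ⟨β, hβ, K, hK, fun q hqU => hq q (h hqU)⟩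

omit D in
lemma Tame.union {U U' : Set (Rn n)} (hU : Tame P σ ψ₂ U) (hU' : Tame P σ ψ₂ U') :
    Tame P σ ψ₂ (U ∪ U') := by
  obtain ⟨β, hβ, K, hK, hq⟩ := hU
  obtain ⟨β', hβ', K', hK', hq'⟩ := hU'
  refine ⟨min β β', lt_min hβ hβ', max K K', hK.trans (le_max_left _ _), ?_⟩
  rintro q (h | h)
  · exact ⟨(mul_le_mul_of_nonneg_right (min_le_left _ _) (P.V_nonneg q)).trans (hq q h).1,
      (hq q h).2.trans (mul_le_mul_of_nonneg_right (le_max_left _ _) (Real.sqrt_nonneg _))⟩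
  · exact ⟨(mul_le_mul_of_nonneg_right (min_le_right _ _) (P.V_nonneg q)).trans (hq' q h).1,
      (hq' q h).2.trans (mul_le_mul_of_nonneg_right (le_max_right _ _) (Real.sqrt_nonneg _))⟩

lemma exists_tame_of_isCompact {C : Set (Rn n)} (hC : IsCompact C) (hCS : C ⊆ P.S) :
    ∃ U, IsOpen U ∧ C ⊆ U ∧ Tame P σ ψ₂ U := by
  refine hC.induction_on (p := fun C => ∃ U, IsOpen U ∧ C ⊆ U ∧ Tame P σ ψ₂ U) ?_ ?_ ?_ ?_
  · exact ⟨∅, isOpen_empty, subset_rfl, 1, one_pos, 0, le_rfl, fun q hq => hq.elim⟩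
  · rintro s t hst ⟨U, hU, htU, hT⟩
    exact ⟨U, hU, hst.trans htU, hT⟩
  · rintro s t ⟨U, hU, hsU, hT⟩ ⟨U', hU', htU', hT'⟩
    exact ⟨U ∪ U', hU.union hU', union_subset_union hsU htU', hT.union hT'⟩
  · intro p hp
    obtain ⟨U, hU, hT⟩ := D.exists_tame_nhds (hCS hp)
    exact ⟨interior U, mem_nhdsWithin_of_mem_nhds (interior_mem_nhds.2 hU), interior U,
      isOpen_interior, subset_rfl, hT.mono interior_subset⟩

lemma exists_θ_le_of_tame {U : Set (Rn n)} (hU : Tame P σ ψ₂ U) : ∃ M, ∀ (p : Rn n)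
    (y : ℝ → Rn n), IsForwardSolution (P.f σ ψ₁ ψ₂) p y → ∀ s t : ℝ, 0 ≤ s → s ≤ t →
      (∀ τ ∈ Icc s t, y τ ∈ U) → P.θ (y t) ≤ P.θ (y s) + M * √(P.V (y s)) := by
  obtain ⟨β, hβ, K, hK, hq⟩ := hU
  -- This is the integral of K exp(−βτ/2) over [0, ∞), the decay rate of √V being β/2.
  refine ⟨2 * K / β, fun p y hy s t hs hst hyU => ?_⟩
  have hsub : Icc s t ⊆ Ici 0 := fun τ hτ => hs.trans hτ.1
  have hcont : ContinuousOn y (Icc s t) := hy.2.continuousOn.mono hsub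
  have hode : ∀ τ ∈ Ico s t, HasDerivWithinAt y (P.f σ ψ₁ ψ₂ (y τ)) (Ici τ) τ := fun τ hτ =>
    (hy.2 τ (hsub (Ico_subset_Icc_self hτ))).mono (Ici_subset_Ici.2 (hs.trans hτ.1))
  have hV : ∀ τ ∈ Icc s t, P.V (y τ) * Real.exp (β * (τ - s)) ≤ P.V (y s) := by
    refine le_of_deriv_right_nonpos_of_lt
      (φ' := fun τ => inner ℝ (gradient P.V (y τ)) (P.f σ ψ₁ ψ₂ (y τ)) * Real.exp (β * (τ - s))
        + P.V (y τ) * (Real.exp (β * (τ - s)) * β))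
      ((D.continuous_V.comp_continuousOn hcont).mul (by fun_prop)) (fun τ hτ => ?_) (by simp)
      (fun τ hτ _ => ?_)
    · refine ((D.hasGradientAt_V _).comp_hasDerivWithinAt (hode τ hτ)).mul ?_
      simpa using ((((hasDerivAt_id τ).sub_const s).const_mul β).exp).hasDerivWithinAt
    · have h1 := D.inner_gradient_V_f_le (y τ)
      have h2 := (hq (y τ) (hyU τ (Ico_subset_Icc_self hτ))).1
      have h3 := Real.exp_pos (β * (τ - s))
      have h4 : inner ℝ (gradient P.V (y τ)) (P.f σ ψ₁ ψ₂ (y τ)) + β * P.V (y τ) ≤ 0 := by linarith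
      calc _ = (inner ℝ (gradient P.V (y τ)) (P.f σ ψ₁ ψ₂ (y τ)) + β * P.V (y τ))
            * Real.exp (β * (τ - s)) := by ring
        _ ≤ 0 := mul_nonpos_of_nonpos_of_nonneg h4 h3.le
  have hsqrt : ∀ τ ∈ Icc s t, √(P.V (y τ)) ≤ √(P.V (y s)) * Real.exp (-(β / 2) * (τ - s)) := by
    intro τ hτ
    refine Real.sqrt_le_iff.2 ⟨by positivity, ?_⟩
    rw [mul_pow, Real.sq_sqrt (P.V_nonneg _), ← Real.exp_nat_mul,
      show ((2 : ℕ) : ℝ) * (-(β / 2) * (τ - s)) = -(β * (τ - s)) by push_cast; ring, Real.exp_neg,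
      ← div_eq_mul_inv, le_div_iff₀ (Real.exp_pos _)]
    exact hV τ hτ
  -- The added exponential decreases at exactly the rate that bounds the growth of θ, so the sum
  -- does not increase.
  have hθ := le_of_deriv_right_nonpos_of_lt
      (φ := fun τ => P.θ (y τ) + 2 * K / β * √(P.V (y s)) * Real.exp (-(β / 2) * (τ - s)))
      (φ' := fun τ => inner ℝ (gradient P.θ (y τ)) (P.f σ ψ₁ ψ₂ (y τ))
        + 2 * K / β * √(P.V (y s)) * (Real.exp (-(β / 2) * (τ - s)) * (-(β / 2))))
      (a := s) (b := t) (c := P.θ (y s) + 2 * K / β * √(P.V (y s)))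
      ((D.continuous_θ.comp_continuousOn hcont).add (by fun_prop)) (fun τ hτ => by
        refine ((D.hasGradientAt_θ _).comp_hasDerivWithinAt (hode τ hτ)).add ?_
        simpa using (((((hasDerivAt_id τ).sub_const s).const_mul (-(β / 2))).exp).const_mul
          (2 * K / β * √(P.V (y s)))).hasDerivWithinAt) (by simp)
      (fun τ hτ _ => by
        have h1 := D.inner_gradient_θ_f_le (y τ)
        have h2 := (hq (y τ) (hyU τ (Ico_subset_Icc_self hτ))).2
        have h3 := mul_le_mul_of_nonneg_left (hsqrt τ (Ico_subset_Icc_self hτ)) hK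
        have h4 : 2 * K / β * √(P.V (y s)) * (Real.exp (-(β / 2) * (τ - s)) * (-(β / 2)))
            = -(K * (√(P.V (y s)) * Real.exp (-(β / 2) * (τ - s)))) := by field_simp
        rw [h4]
        linarith) t ⟨hst, le_rfl⟩
  refine le_trans ?_ hθ
  simp only [le_add_iff_nonneg_right]
  positivity

/-! ### Convergence to KKT points -/

omit D in
-- Fix s and let t → ∞ along the sequence for p, then let s → ∞ along that for q. It serves V with e
-- = 0 and θ with e = M√V, which vanishes on S.
lemma le_of_mem_positiveLimitSet {y : ℝ → Rn n} {φ e : Rn n → ℝ} (hφ : Continuous φ)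
    (he : Continuous e) {T : ℝ} (h : ∀ s t, T ≤ s → s ≤ t → φ (y t) ≤ φ (y s) + e (y s))
    {p q : Rn n} (hp : p ∈ positiveLimitSet y) (hq : q ∈ positiveLimitSet y) (heq : e q = 0) :
    φ p ≤ φ q := by
  obtain ⟨t, ht, htp⟩ := hp
  obtain ⟨s, hs, hsq⟩ := hq
  have h1 : ∀ᶠ j in atTop, φ p ≤ φ (y (s j)) + e (y (s j)) := by
    filter_upwards [hs.eventually_ge_atTop T] with j hj
    refine le_of_tendsto ((hφ.tendsto p).comp htp) ?_
    filter_upwards [ht.eventually_ge_atTop (s j)] with i hi using h _ _ hj hi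
  have h2 := ((hφ.tendsto q).comp hsq).add ((he.tendsto q).comp hsq)
  rw [heq, add_zero] at h2
  exact ge_of_tendsto h2 h1

/-- Global existence, uniqueness and convergence to the set of KKT points. -/
lemma exists_isForwardSolution (x₀ : Rn n) :
    ∃ x : ℝ → Rn n, IsForwardSolution (P.f σ ψ₁ ψ₂) x₀ x ∧
      (∀ (T : ℝ) (y : ℝ → Rn n), IsSolutionUpTo (P.f σ ψ₁ ψ₂) x₀ T y → EqOn y x (Ico 0 T)) ∧
      Bornology.IsBounded (x '' Ici 0) ∧
      (positiveLimitSet x).Nonempty ∧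
      IsCompact (positiveLimitSet x) ∧
      IsConnected (positiveLimitSet x) ∧
      IsInvariantSet (P.f σ ψ₁ ψ₂) (positiveLimitSet x) ∧
      positiveLimitSet x ⊆ P.Φ := by
  obtain ⟨C, v, K, L, x, hC, hv, hL, hvf, hx0, hx, hxC⟩ := D.exists_trapped x₀
  have hev : ∀ᶠ t in atTop, x t ∈ C := (eventually_ge_atTop 0).mono hxC
  have hsol : IsForwardSolution (P.f σ ψ₁ ψ₂) x₀ x :=
    ⟨hx0, fun t ht => by
      have h : HasDerivAt x (v (x t)) t := hx t
      rw [hvf _ (hxC t ht)] at h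
      exact h.hasDerivWithinAt⟩
  have hLC : positiveLimitSet x ⊆ C := positiveLimitSet_subset hC.isClosed hev
  have hcompact := isCompact_positiveLimitSet hC hev
  have hthrough : ∀ p ∈ positiveLimitSet x, ∃ z : ℝ → Rn n, z 0 = p ∧
      (IsIntegralCurve z fun _ => P.f σ ψ₁ ψ₂) ∧ ∀ t, z t ∈ positiveLimitSet x := fun p hp => by
    obtain ⟨z, hz0, hz⟩ := hv.exists_isIntegralCurve hL p
    have hmem := hv.mem_positiveLimitSet hx hz (hz0 ▸ hp)
    refine ⟨z, hz0, fun t => ?_, hmem⟩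
    have h : HasDerivAt z (v (z t)) t := hz t
    rwa [hvf _ (hLC (hmem t))] at h
  -- LaSalle's argument: a function constant on the limit set has zero derivative along the solution
  -- that stays in it.
  have hconst {φ : Rn n → ℝ} (hφ : ∀ q, HasGradientAt φ (gradient φ q) q)
      (hle : ∀ p ∈ positiveLimitSet x, ∀ q ∈ positiveLimitSet x, φ p ≤ φ q) :
      ∀ p ∈ positiveLimitSet x, inner ℝ (gradient φ p) (P.f σ ψ₁ ψ₂ p) = 0 := fun p hp => by
    obtain ⟨z, hz0, hz, hmem⟩ := hthrough p hp
    have h1 := (hφ (z 0)).comp_hasDerivWithinAt ((hz 0).hasDerivWithinAt (s := univ))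
    rw [hasDerivWithinAt_univ, hz0] at h1
    have h2 : (fun τ => φ (z τ)) = fun _ => φ p := funext fun τ =>
      le_antisymm (hle _ (hmem τ) _ hp) (hle _ hp _ (hmem τ))
    rw [h2] at h1
    exact h1.unique (hasDerivAt_const 0 (φ p))
  have hVanti (s t : ℝ) (hs : 0 ≤ s) (hst : s ≤ t) : P.V (x t) ≤ P.V (x s) :=
    D.V_le_of_isSolutionUpTo (hsol.isSolutionUpTo (t + 1)) hs hst (lt_add_one t)
  have hLS : positiveLimitSet x ⊆ P.S := fun p hp =>
    D.mem_S_of_inner_eq_zero (hconst D.hasGradientAt_V (fun p hp q hq =>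
      le_of_mem_positiveLimitSet (e := 0) D.continuous_V continuous_const (T := 0)
        (fun s t hs hst => by simpa using hVanti s t hs hst) hp hq rfl) p hp)
  obtain ⟨U, hU, hLU, hT⟩ := D.exists_tame_of_isCompact hcompact hLS
  obtain ⟨M, hM⟩ := D.exists_θ_le_of_tame hT
  obtain ⟨T, hTU⟩ := eventually_atTop.1 (eventually_mem_of_positiveLimitSet_subset hC hev hU hLU)
  have hLΦ : positiveLimitSet x ⊆ P.Φ := fun p hp =>
    D.mem_Φ_of_inner_eq_zero (hLS hp) (hconst D.hasGradientAt_θ (fun p hp q hq =>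
      le_of_mem_positiveLimitSet (e := fun q => M * √(P.V q)) D.continuous_θ
        (continuous_const.mul D.continuous_V.sqrt) (T := max T 0)
        (fun s t hs hst => hM x₀ x hsol s t ((le_max_right _ _).trans hs) hst fun τ hτ =>
          hTU τ (((le_max_left _ _).trans hs).trans hτ.1)) hp hq
        (by simp [mem_S_iff_V_eq_zero.1 (hLS hq)])) p hp)
  refine ⟨x, hsol, fun T y hy => D.lipschitz_f.eqOn_of_isSolutionUpTo hy (hsol.isSolutionUpTo T),
    hC.isBounded.subset (image_subset_iff.2 hxC), positiveLimitSet_nonempty hC hev, hcompact,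
    isConnected_positiveLimitSet hC hev hx.continuous.continuousOn, fun p hp => ?_, hLΦ⟩
  obtain ⟨z, hz0, hz, hmem⟩ := hthrough p hp
  refine ⟨⟨z, hz0, hz⟩, fun z' hz'0 hz' t => ?_⟩
  rw [D.lipschitz_f.isIntegralCurve_unique hz' hz (hz'0.trans hz0.symm)]
  exact hmem t

/-! ### Asymptotic stability of isolated strict local minima -/

/-- Solutions that start close to a strict local minimum stay close to it. -/
lemma exists_forall_dist_lt {p : Rn n} (hp : P.IsStrictLocalMinimum p) {ε : ℝ} (hε : 0 < ε) :
    ∃ δ > 0, ∀ x₀, dist x₀ p < δ → ∀ y, IsForwardSolution (P.f σ ψ₁ ψ₂) x₀ y →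
      ∀ t, 0 ≤ t → dist (y t) p < ε := by
  obtain ⟨hpS, ε₁, hε₁, hmin⟩ := hp
  obtain ⟨U, hU, hT⟩ := D.exists_tame_nhds hpS
  obtain ⟨ε₂, hε₂, hball⟩ := Metric.nhds_basis_closedBall.mem_iff.1 hU
  obtain ⟨M, hM⟩ := D.exists_θ_le_of_tame (hT.mono hball)
  set r := min ε (min (ε₁ / 2) ε₂) with hr
  have hr0 : 0 < r := by positivity
  have hrε₁ : r < ε₁ := ((min_le_right _ _).trans (min_le_left _ _)).trans_lt (half_lt_self hε₁)
  have hrε₂ : r ≤ ε₂ := (min_le_right _ _).trans (min_le_right _ _)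
  have hVp : P.V p = 0 := mem_S_iff_V_eq_zero.1 hpS
  -- On the sphere either q is infeasible and V > 0, or q is feasible and θ(q) > θ(p); compactness
  -- makes this uniform.
  obtain ⟨η, hη, hsphere⟩ : ∃ η > 0, ∀ q ∈ Metric.sphere p r,
      η ≤ max (P.V q) (P.θ q - P.θ p) := by
    refine (isCompact_sphere p r).exists_forall_le'
      (D.continuous_V.max (D.continuous_θ.sub continuous_const)).continuousOn fun q hq => ?_
    rw [Metric.mem_sphere] at hq
    rcases (P.V_nonneg q).eq_or_lt with h | h
    · refine lt_max_of_lt_right (sub_pos.2 (hmin q (mem_S_iff_V_eq_zero.2 h.symm) ?_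
        (hq ▸ hrε₁)))
      rintro rfl
      rw [dist_self] at hq
      exact hr0.ne hq
    · exact lt_max_of_lt_left h
  have hnear : ∀ᶠ q in 𝓝 p, P.V q < η ∧ P.θ q + M * √(P.V q) < P.θ p + η ∧ dist q p < r := by
    refine ((D.continuous_V.continuousAt.eventually_lt continuousAt_const (by rwa [hVp])).and
      ((ContinuousAt.eventually_lt (g := fun _ => P.θ p + η)
        (D.continuous_θ.add (continuous_const.mul D.continuous_V.sqrt)).continuousAt
        continuousAt_const ?_).and (Metric.ball_mem_nhds p hr0)))
    simpa [hVp] using hη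
  obtain ⟨δ, hδ, hδ'⟩ := Metric.eventually_nhds_iff.1 hnear
  refine ⟨δ, hδ, fun x₀ hx₀ y hy t ht => ?_⟩
  obtain ⟨hVx, hθx, hxr⟩ := hδ' hx₀
  refine lt_of_lt_of_le ?_ (min_le_left ε (min (ε₁ / 2) ε₂))
  by_contra hcon
  have hyc : ContinuousOn y (Icc 0 t) := hy.2.continuousOn.mono fun τ hτ => hτ.1
  have hdc : ContinuousOn (fun τ => dist (y τ) p) (Icc 0 t) :=
    (continuous_id.dist continuous_const).comp_continuousOn hyc
  have hcl : IsCompact (Icc 0 t ∩ (fun τ => dist (y τ) p) ⁻¹' Ici r) :=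
    isCompact_Icc.of_isClosed_subset (hdc.preimage_isClosed_of_isClosed isClosed_Icc isClosed_Ici)
      inter_subset_left
  -- Up to the first time t₁ on the sphere the solution stays in the tame ball; at t₁ the bounds on
  -- V and θ contradict the choice of η.
  obtain ⟨t₁, ⟨ht₁, hrt₁⟩, hleast⟩ := hcl.exists_isLeast ⟨t, ⟨ht, le_rfl⟩, not_lt.1 hcon⟩
  have hin : ∀ τ ∈ Icc 0 t₁, dist (y τ) p ≤ r := by
    intro τ hτ
    by_contra hlt
    obtain ⟨s, hs, hsr⟩ := intermediate_value_Icc hτ.1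
      (hdc.mono (Icc_subset_Icc_right (hτ.2.trans ht₁.2)))
      (show r ∈ Icc (dist (y 0) p) (dist (y τ) p) from
        ⟨by rw [hy.1]; exact hxr.le, (not_le.1 hlt).le⟩)
    have h1 := hleast ⟨⟨hs.1, (hs.2.trans hτ.2).trans ht₁.2⟩, hsr.ge⟩
    have h2 : s = τ := le_antisymm hs.2 (hτ.2.trans h1)
    exact hlt (h2 ▸ hsr.le)
  have hθ := hM x₀ y hy 0 t₁ le_rfl ht₁.1 fun τ hτ => (hin τ hτ).trans hrε₂
  have hV := D.V_le_of_isSolutionUpTo (hy.isSolutionUpTo (t₁ + 1)) le_rfl ht₁.1 (lt_add_one t₁)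
  rw [hy.1] at hθ hV
  rcases le_max_iff.1 (hsphere (y t₁) (le_antisymm (hin t₁ ⟨ht₁.1, le_rfl⟩) hrt₁)) with h | h
  · linarith
  · linarith

lemma isLocallyAsymptoticallyStable {p : Rn n} (hiso : P.IsIsolatedKKT p)
    (hp : P.IsStrictLocalMinimum p) : IsLocallyAsymptoticallyStable (P.f σ ψ₁ ψ₂) p := by
  refine ⟨(D.f_eq_zero_iff p).2 hiso.1, fun ε hε => ?_, ?_⟩
  · obtain ⟨δ, hδ, h⟩ := D.exists_forall_dist_lt hp hε
    refine ⟨δ, hδ, fun x₀ hx₀ => ⟨?_, h x₀ hx₀⟩⟩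
    obtain ⟨x, hx, -⟩ := D.exists_isForwardSolution x₀
    exact ⟨x, hx⟩
  · obtain ⟨-, ε, hε, hKKT⟩ := hiso
    obtain ⟨δ, hδ, h⟩ := D.exists_forall_dist_lt hp (half_pos hε)
    refine ⟨δ, hδ, fun x₀ hx₀ y hy => ?_⟩
    obtain ⟨x, hx, huniq, -, -, -, -, -, hΦ⟩ := D.exists_isForwardSolution x₀
    have hyx : EqOn y x (Ici 0) := fun t ht =>
      huniq (t + 1) y (hy.isSolutionUpTo _) ⟨ht, lt_add_one t⟩
    have hxball : ∀ᶠ t in atTop, x t ∈ Metric.closedBall p (ε / 2) := by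
      filter_upwards [eventually_ge_atTop 0] with t ht
      exact (h x₀ hx₀ x hx t ht).le
    have hsub := positiveLimitSet_subset Metric.isClosed_closedBall hxball
    refine (tendsto_of_positiveLimitSet_subset_singleton (isCompact_closedBall p (ε / 2)) hxball
      fun q hq => ?_).congr' ?_
    · exact hKKT q (hΦ hq) ((Metric.mem_closedBall.1 (hsub hq)).trans_lt (half_lt_self hε))
    · filter_upwards [eventually_ge_atTop 0] with t ht using (hyx ht).symm

end Standing

end NLP

theorem theorem5p3 {n m k : ℕ} (hmn : m < n) (P : NLP n m k)
    (hθ : ContDiff ℝ 2 P.θ) (hh : ∀ i, ContDiff ℝ 2 (P.h i)) (hg : ∀ j, ContDiff ℝ 2 (P.g j))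
    (hA1 : P.SublevelCompact) (hA2 : P.LICQ) (hA3 : P.NoInfeasibleCritical)
    (ψ₁ ψ₂ : Rn n → ℝ)
    (hψ₁ : LocallyLipschitz ψ₁) (hψ₁pos : ∀ x, 0 < ψ₁ x)
    (hψ₂ : LocallyLipschitz ψ₂) (hψ₂pos : ∀ x, 0 < ψ₂ x)
    (hA4 : P.SublevelInclusion ψ₁ ψ₂)
    (σ : Rn n → ℝ) (hσ : LocallyLipschitz σ) (hσpos : ∀ x, 0 < σ x) :
    LocallyLipschitz P.F ∧ LocallyLipschitz (P.f σ ψ₁ ψ₂) ∧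
    -- global existence, uniqueness, boundedness, and the positive limit sets
    (∀ x₀ : Rn n, ∃ x : ℝ → Rn n, IsForwardSolution (P.f σ ψ₁ ψ₂) x₀ x ∧
      (∀ (T : ℝ) (y : ℝ → Rn n), IsSolutionUpTo (P.f σ ψ₁ ψ₂) x₀ T y → EqOn y x (Ico 0 T)) ∧
      Bornology.IsBounded (x '' Ici 0) ∧
      (positiveLimitSet x).Nonempty ∧
      IsCompact (positiveLimitSet x) ∧
      IsConnected (positiveLimitSet x) ∧
      IsInvariantSet (P.f σ ψ₁ ψ₂) (positiveLimitSet x) ∧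
      positiveLimitSet x ⊆ P.Φ) ∧
    -- the equilibria are exactly the KKT points
    (∀ p, P.f σ ψ₁ ψ₂ p = 0 ↔ p ∈ P.Φ) ∧
    -- isolated KKT points that are strict local minima are locally asymptotically stable
    (∀ p, P.IsIsolatedKKT p → P.IsStrictLocalMinimum p →
      IsLocallyAsymptoticallyStable (P.f σ ψ₁ ψ₂) p) ∧
    -- the feasible set is positively invariant
    IsPositivelyInvariantSet (P.f σ ψ₁ ψ₂) P.S := by
  have D : P.Standing σ ψ₁ ψ₂ :=
    ⟨hθ, hh, hg, hA1, hA2, hA3, hψ₁, hψ₁pos, hψ₂, hψ₂pos, hA4, hσ, hσpos⟩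
  exact ⟨NLP.locallyLipschitz_F hθ hh hg, D.lipschitz_f, D.exists_isForwardSolution,
    D.f_eq_zero_iff, fun _ => D.isLocallyAsymptoticallyStable, D.isPositivelyInvariantSet_S⟩
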